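/- Conventions. Let $k,m\ge 0$ be integers. A noncommutative probability space $(\mathcal A,\varphi)$ is a unital complex algebra with a linear functional $\varphi$, $\varphi(1)=1$. An infinitesimal noncommutative probability space of order $k$ is a unital complex algebra $\mathcal A$ with linear functionals $\varphi^{(0)},\dots,\varphi^{(k)}$ such that $\varphi^{(0)}(1)=1$ and $\varphi^{(i)}(1)=0$ for $1\le i\le k$. Its infinitesimal cumulants $\kappa^{(i)}_n:\mathcal A^n\to\mathbb C$ ($n\ge1$, $0\le i\le k$) are determined by $$\varphi^{(i)}(a_1\cdots a_n)=\sum_{p=\{V_1,\dots,V_h\}\in NC(n)}\ \sum_{\lambda_1+\dots+\lambda_h=i}\frac{i!}{\lambda_1!\cdots\lambda_h!}\prod_{j=1}^h\kappa^{(\lambda_j)}_{|V_j|}\big((a_1,\dots,a_n)|V_j\big),$$ where $NC(n)$ is the set of non-crossing partitions of $\{1,\dots,n\}$, the $\lambda_j$ are non-negative integers, and $(a_1,\dots,a_n)|V=(a_{v_1},\dots,a_{v_r})$ for $V=\{v_1<\dots<v_r\}$. Two subsets of $\mathcal A$ are infinitesimally free of order $k$ if $\kappa_n^{(i)}(a_1,\dots,a_n)=0$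 for all $n$ and all $0\le i\le k$ whenever each $a_j$ is taken from one of the two subsets and not all are taken from the same one. The infinitesimal distribution of $(a_1,\dots,a_m)\in\mathcal A^m$ is the family of functionals $P\mapsto\varphi^{(i)}(P(a_1,\dots,a_m))$, $0\le i\le k$, on $\mathbb C\langle X_1,\dots,X_m\rangle$. If $\{a_1,\dots,a_m\}$ and $\{b_1,\dots,b_m\}$ are infinitesimally free of order $k$, with infinitesimal distributions $(\mu^{(i)})_{0\le i\le k}$ and $(\nu^{(i)})_{0\le i\le k}$, then the infinitesimal distribution of $(a_1+b_1,\dots,a_m+b_m)$, respectively of $(a_1b_1,\dots,a_mb_m)$, is called their infinitesimal free additive convolution $(\mu^{(i)})\boxplus^{(k)}(\nu^{(i)})$, respectively their infinitesimal free multiplicative convolution $(\mu^{(i)})\boxtimes^{(k)}(\nu^{(i)})$, of order $k$. The usual free convolutions $\mu\boxplus\nu$ and $\mu\boxtimes\nu$ of two functionals with $\mu(1)=\nu(1)=1$ are defined in the same way from $m$-tuples that are free (i.e. generate free unital subalgebras) in a noncommutative probability space. Proposition. Let $K\subseteq\mathbb R$ have $0$ as an accumulation point, and let $(\mu_t)_{t\in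 K}$, $(\nu_t)_{t\in K}$ be families of linear functionals on the algebra of noncommutative polynomials in $m$ variables with $\mu_t(1)=\nu_t(1)=1$. Assume that the derivatives $\mu^{(i)}=\frac{d^i}{dt^i}\big|_{t=0}\mu_t$ and $\nu^{(i)}=\frac{d^i}{dt^i}\big|_{t=0}\nu_t$ exist for $0\le i\le k$, where these are defined recursively by the pointwise limits $$\frac{\mu^{(i)}}{i!}=\lim_{t\to0,\ t\in K\setminus\{0\}}\frac1{t^i}\Big(\mu_t-\sum_{j=0}^{i-1}\frac{t^j}{j!}\mu^{(j)}\Big)$$ (so that $\mu^{(0)}=\lim_{t\to 0}\mu_t$), and likewise for $\nu$. Then $\mu_t\boxplus\nu_t$ and $\mu_t\boxtimes\nu_t$ (for $t\in K$) and $$(\eta^{(i)})_{0\le i\le k}:=(\mu^{(i)})_{0\le i\le k}\boxplus^{(k)}(\nu^{(i)})_{0\le i\le k},\qquad(\theta^{(i)})_{0\le i\le k}:=(\mu^{(i)})_{0\le i\le k}\boxtimes^{(k)}(\nu^{(i)})_{0\le i\le k}$$ are well defined (they exist and are unique), the derivatives at $0$ of orders $0\le i\le k$ of $\mu_t\boxplus\nu_t$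 and of $\mu_t\boxtimes\nu_t$ exist in the same sense, and $$\eta^{(i)}=\frac{d^i}{dt^i}\Big|_{t=0}(\mu_t\boxplus\nu_t),\qquad \theta^{(i)}=\frac{d^i}{dt^i}\Big|_{t=0}(\mu_t\boxtimes\nu_t)\qquad(0\le i\le k).$$ -/

import Mathlib

open Filter Topology

noncomputable section

namespace InfFree

/-! ### Non-crossing partitions of a finite totally ordered set -/

/-- A partition of `{0 < 1 < ⋯ < n-1}` is non-crossing if `a < b < c < d`, `a ∼ c` and `b ∼ d`
force `a ∼ b`. -/
def IsNoncrossing {n : ℕ} (p : Finpartition (Finset.univ : Finset (Fin n))) : Prop :=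
  ∀ V ∈ p.parts, ∀ W ∈ p.parts, ∀ a ∈ V, ∀ b ∈ W, ∀ c ∈ V, ∀ d ∈ W,
    a < b → b < c → c < d → V = W

open Classical in
/-- The finite set of non-crossing partitions of `{0 < 1 < ⋯ < n-1}`. -/
def NC (n : ℕ) : Finset (Finpartition (Finset.univ : Finset (Fin n))) :=
  Finset.univ.filter IsNoncrossing

/-- `(a_1, …, a_n) | V = (a_{v_1}, …, a_{v_m})` for `V = {v_1 < ⋯ < v_m}`. -/
def restrict {α : Type*} {n : ℕ} (a : Fin n → α) (V : Finset (Fin n)) : Fin V.card → α :=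
  fun j => a (V.orderEmbOfFin rfl j)

/-- The set `Λ` of families `(λ_V)` of natural numbers with sum `i`, indexed by the blocks of a
partition. As `i ≤ k`, all the entries are at most `k`. -/
def Lam {β : Type*} [Fintype β] [DecidableEq β] {k : ℕ} (i : Fin (k + 1)) :
    Finset (β → Fin (k + 1)) :=
  Finset.univ.filter fun l => ∑ V, (l V : ℕ) = (i : ℕ)

/-- The multinomial coefficient `(∑ λ_V)! / ∏ λ_V!`. -/
def multi {β : Type*} [Fintype β] {k : ℕ} (l : β → Fin (k + 1)) : ℂ :=
  (Nat.multinomial Finset.univ fun V => (l V : ℕ) : ℕ)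

lemma card_lt_of_ne_univ {n : ℕ} (V : Finset (Fin n)) (h : V ≠ Finset.univ) : V.card < n := by
  simpa using Finset.card_lt_card (Finset.ssubset_univ_iff.mpr h)

section Spaces

variable {A : Type*} [Ring A] [Algebra ℂ A]

/-! ### Infinitesimal noncommutative probability spaces of order `k` -/

/-- `φ^{(0)}(1) = 1` and `φ^{(i)}(1) = 0` for `1 ≤ i ≤ k`: the pair `(A, φ)` is an infinitesimal
noncommutative probability space of order `k`. -/
def IsInfState {k : ℕ} (φ : Fin (k + 1) → (A →ₗ[ℂ] ℂ)) : Prop :=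
  ∀ i, φ i 1 = if i = 0 then 1 else 0

/-- The distribution `P ↦ φ (P(a_1, …, a_m))` of a tuple. -/
def distr {m : ℕ} (φ : A →ₗ[ℂ] ℂ) (a : Fin m → A) : FreeAlgebra ℂ (Fin m) →ₗ[ℂ] ℂ :=
  φ ∘ₗ (FreeAlgebra.lift ℂ a).toLinearMap

open Classical in
/-- The infinitesimal non-crossing cumulant `κ_n^{(i)}(a_1, …, a_n)`: the infinitesimal
moment-cumulant formula (see `moment_cumulant`), solved for the term of the one-block partition. -/
def cumulant {k : ℕ} (φ : Fin (k + 1) → (A →ₗ[ℂ] ℂ)) (n : ℕ) (i : Fin (k + 1))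
    (a : Fin n → A) : ℂ :=
  φ i (List.ofFn a).prod -
    ∑ p ∈ ((NC n).filter fun p => Finset.univ ∉ p.parts).attach,
      ∑ l ∈ Lam (β := p.1.parts) i,
        multi l * ∏ V : p.1.parts, cumulant φ V.1.card (l V) (restrict a V.1)
termination_by n
decreasing_by
  exact card_lt_of_ne_univ V.1
    (fun h => (Finset.mem_filter.mp p.2).2 (Eq.subst (motive := fun W => W ∈ p.1.parts) h V.2))

lemma cumulant_restrict_univ {k : ℕ} (φ : Fin (k + 1) → (A →ₗ[ℂ] ℂ)) {n : ℕ}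
    (i : Fin (k + 1)) (a : Fin n → A) :
    cumulant φ (Finset.univ : Finset (Fin n)).card i (restrict a Finset.univ) =
      cumulant φ n i a := by
  have key : ∀ (m : ℕ) (f : Fin m ↪o Fin n), m = n →
      cumulant φ m i (fun j => a (f j)) = cumulant φ n i a := by
    intro m f hm
    subst hm
    have : ∀ j, f j = j := fun j => by
      have h := Subsingleton.elim (f.strictMono.orderIsoOfSurjective f
        (Finite.surjective_of_injective f.injective)) (OrderIso.refl _)
      exact congrArg (fun g : Fin m ≃o Fin m => g j) h
    simp [this]
  exact key _ _ (by simp)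

open Classical in
/-- The infinitesimal moment-cumulant formula, which determines the cumulants uniquely. -/
theorem moment_cumulant {k : ℕ} (φ : Fin (k + 1) → (A →ₗ[ℂ] ℂ)) {n : ℕ} (hn : 1 ≤ n)
    (i : Fin (k + 1)) (a : Fin n → A) :
    ∑ p ∈ NC n, ∑ l ∈ Lam (β := p.parts) i,
        multi l * ∏ V : p.parts, cumulant φ V.1.card (l V) (restrict a V.1) =
      φ i (List.ofFn a).prod := by
  have hne : (Finset.univ : Finset (Fin n)).Nonempty := ⟨⟨0, hn⟩, Finset.mem_univ _⟩
  rw [← Finset.sum_filter_add_sum_filter_not (NC n) (fun p => Finset.univ ∈ p.parts)]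
  have hone : ∀ p : Finpartition (Finset.univ : Finset (Fin n)), Finset.univ ∈ p.parts →
      p.parts = {Finset.univ} := by
    intro p hp
    ext V
    constructor
    · intro hV
      by_contra hVn
      have hd := p.disjoint hV hp (by simpa using hVn)
      have : V = ⊥ := Disjoint.eq_bot_of_le hd (Finset.subset_univ V)
      exact p.ne_bot hV this
    · intro hV
      rw [Finset.mem_singleton.mp hV]
      exact hp
  have hp0 : ((NC n).filter fun p => Finset.univ ∈ p.parts) =
      {Finpartition.indiscrete hne.ne_empty} := by
    ext p
    simp only [Finset.mem_filter, Finset.mem_singleton]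
    constructor
    · rintro ⟨-, h⟩
      exact Finpartition.ext (by simpa using hone p h)
    · rintro rfl
      refine ⟨?_, by simp⟩
      simp only [NC, Finset.mem_filter, Finset.mem_univ, true_and]
      intro V hV W hW
      simp_all
  have h1 : ∀ p : Finpartition (Finset.univ : Finset (Fin n)), Finset.univ ∈ p.parts →
      ∑ l ∈ Lam (β := p.parts) i,
        multi l * ∏ V : p.parts, cumulant φ V.1.card (l V) (restrict a V.1) =
      cumulant φ n i a := by
    intro p hp
    have hs : ∀ V : p.parts, V = ⟨Finset.univ, hp⟩ := by
      intro V
      have h : ∀ W ∈ p.parts, W = Finset.univ := fun W hW => by simpa [hone p hp] using hW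
      exact Subtype.ext (h V.1 V.2)
    have huniv : (Finset.univ : Finset p.parts) = {⟨Finset.univ, hp⟩} := by
      ext V
      simp [hs V]
    have hL : Lam (β := p.parts) i = {fun _ => i} := by
      ext l
      simp only [Lam, huniv, Finset.mem_filter, Finset.mem_univ, true_and,
        Finset.sum_singleton, Finset.mem_singleton]
      constructor
      · intro h
        funext V
        rw [hs V]
        exact Fin.ext h
      · rintro rfl
        rfl
    rw [hL, Finset.sum_singleton, huniv, Finset.prod_singleton, cumulant_restrict_univ]
    simp [multi, huniv]
  rw [hp0, Finset.sum_singleton, h1 _ (by simp), cumulant]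
  rw [Finset.sum_attach ((NC n).filter fun p => Finset.univ ∉ p.parts)
    (fun p => ∑ l ∈ Lam (β := p.parts) i,
      multi l * ∏ V : p.parts, cumulant φ V.1.card (l V) (restrict a V.1))]
  simp

/-- Subsets are infinitesimally free of order `k` if their mixed infinitesimal cumulants vanish. -/
def InfinitesimallyFree {k : ℕ} (φ : Fin (k + 1) → (A →ₗ[ℂ] ℂ)) {ι : Type*}
    (M : ι → Set A) : Prop :=
  ∀ (i : Fin (k + 1)) (n : ℕ) (a : Fin n → A) (c : Fin n → ι),
    (∀ j, a j ∈ M (c j)) → (∃ s t, c s ≠ c t) → cumulant φ n i a = 0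

/-! ### Freeness in a usual noncommutative probability space -/

/-- Subsets are free in `(A, φ)` if the unital subalgebras they generate are free:
`φ(a_1 ⋯ a_n) = 0` for every alternating product of `n ≥ 1` centered elements. -/
def Free (φ : A →ₗ[ℂ] ℂ) {ι : Type*} (M : ι → Set A) : Prop :=
  ∀ (n : ℕ) (a : Fin n → A) (c : Fin n → ι), 1 ≤ n →
    (∀ j, a j ∈ Algebra.adjoin ℂ (M (c j))) → (∀ j, φ (a j) = 0) →
    (∀ j j' : Fin n, (j : ℕ) + 1 = j' → c j ≠ c j') → φ (List.ofFn a).prod = 0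

end Spaces

/-! ### Convolutions. Linear functionals on `ℂ⟨X_1, …, X_m⟩` -/

/-- `σ = μ ⊞ ν`: `σ` is the distribution of `(a_1 + b_1, …, a_m + b_m)` for some tuples `a`, `b`
with distributions `μ`, `ν` that are free in some noncommutative probability space. -/
def IsFreeAddConv {m : ℕ} (μ ν σ : FreeAlgebra ℂ (Fin m) →ₗ[ℂ] ℂ) : Prop :=
  ∃ (A : Type) (_ : Ring A) (_ : Algebra ℂ A) (φ : A →ₗ[ℂ] ℂ) (a b : Fin m → A),
    φ 1 = 1 ∧ Free φ ![Set.range a, Set.range b] ∧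
    distr φ a = μ ∧ distr φ b = ν ∧ distr φ (fun u => a u + b u) = σ

/-- `σ = μ ⊠ ν`: the same with the tuple `(a_1 b_1, …, a_m b_m)`. -/
def IsFreeMulConv {m : ℕ} (μ ν σ : FreeAlgebra ℂ (Fin m) →ₗ[ℂ] ℂ) : Prop :=
  ∃ (A : Type) (_ : Ring A) (_ : Algebra ℂ A) (φ : A →ₗ[ℂ] ℂ) (a b : Fin m → A),
    φ 1 = 1 ∧ Free φ ![Set.range a, Set.range b] ∧
    distr φ a = μ ∧ distr φ b = ν ∧ distr φ (fun u => a u * b u) = σ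

/-- `η = μ ⊞^{(k)} ν`: `η` is the infinitesimal distribution of `(a_1 + b_1, …, a_m + b_m)` for
some tuples `a`, `b` with infinitesimal distributions `μ`, `ν` such that `{a_1, …, a_m}` and
`{b_1, …, b_m}` are infinitesimally free of order `k` in some infinitesimal noncommutative
probability space of order `k`. -/
def IsInfFreeAddConv {k m : ℕ} (μ ν η : Fin (k + 1) → (FreeAlgebra ℂ (Fin m) →ₗ[ℂ] ℂ)) : Prop :=
  ∃ (A : Type) (_ : Ring A) (_ : Algebra ℂ A) (φ : Fin (k + 1) → (A →ₗ[ℂ] ℂ))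
    (a b : Fin m → A),
    IsInfState φ ∧ InfinitesimallyFree φ ![Set.range a, Set.range b] ∧
    (∀ i, distr (φ i) a = μ i) ∧ (∀ i, distr (φ i) b = ν i) ∧
    (∀ i, distr (φ i) (fun u => a u + b u) = η i)

/-- `θ = μ ⊠^{(k)} ν`: the same with the tuple `(a_1 b_1, …, a_m b_m)`. -/
def IsInfFreeMulConv {k m : ℕ} (μ ν θ : Fin (k + 1) → (FreeAlgebra ℂ (Fin m) →ₗ[ℂ] ℂ)) : Prop :=
  ∃ (A : Type) (_ : Ring A) (_ : Algebra ℂ A) (φ : Fin (k + 1) → (A →ₗ[ℂ] ℂ))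
    (a b : Fin m → A),
    IsInfState φ ∧ InfinitesimallyFree φ ![Set.range a, Set.range b] ∧
    (∀ i, distr (φ i) a = μ i) ∧ (∀ i, distr (φ i) b = ν i) ∧
    (∀ i, distr (φ i) (fun u => a u * b u) = θ i)

/-! ### Derivatives at `0` of a family indexed by `K ⊆ ℝ` -/

/-- The derivatives at `0` of orders `0, …, k` of `(μ_t)_{t ∈ K}` exist and are
`d^{(0)}, …, d^{(k)}`: for each `i ≤ k`, pointwise on polynomials and along `t ∈ K`, `t ≠ 0`,
`t^{-i} (μ_t - ∑_{j<i} (t^j / j!) d^{(j)}) → d^{(i)} / i!` as `t → 0`. -/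
def HasDerivsAtZero {k m : ℕ} (K : Set ℝ) (μ : ℝ → (FreeAlgebra ℂ (Fin m) →ₗ[ℂ] ℂ))
    (d : Fin (k + 1) → (FreeAlgebra ℂ (Fin m) →ₗ[ℂ] ℂ)) : Prop :=
  ∀ (i : Fin (k + 1)) (P : FreeAlgebra ℂ (Fin m)),
    Tendsto
      (fun t : ℝ => (1 / (t : ℂ) ^ (i : ℕ)) *
        (μ t P - ∑ j ∈ Finset.Iio i, ((t : ℂ) ^ (j : ℕ) / (Nat.factorial (j : ℕ) : ℂ)) * d j P))
      (𝓝[K \ {0}] 0) (𝓝 (d i P / (Nat.factorial (i : ℕ) : ℂ)))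

end InfFree

end

/-! Freeness, in either sense, means that mixed cumulants vanish. The joint moments of the two
tuples are therefore universal polynomials in the moments of each: pass from moments to cumulants,
put the mixed ones equal to zero, and sum over non-crossing partitions (`jointDistr`). The
infinitesimal moment-cumulant formula of order `i` is the `i`-th derivative of the one of order
zero, its multinomial coefficients being those of the Leibniz rule (`coeff_prod_jetSeries`). Hence
Taylor expansions at `0` pass from moments to cumulants (`hasJet_wordCumulant`) and from cumulants
to joint moments (`hasJet_jointDistr`), and both convolutions are obtained by evaluating joint
moments at sums or products of the generators.

Two points need an argument. Infinitesimal freeness is defined by cumulants, so there the joint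
distribution comes from inverting the moment-cumulant formula (`InfinitesimallyFree.joint_eq`).
Usual freeness is defined by alternating products of centered elements, and the bridge to cumulants
is a model on the full Fock space. Its vacuum moments are sums over non-crossing partitions
(`vacuum_prod_fockOp`), and its operators of different colours are free once the mixed weights
vanish (`free_vacuum`). Freeness determines the joint distribution (`Free.unique`), so every free
pair has the joint distribution of the model (`Free.joint_eq`); the model also gives existence.

On the analytic side, the limits defining the derivatives of orders `0, …, k` amount to one
expansion with error `o(t^k)` (`HasJet`, `hasDerivsAtZero_iff`), a notion stable under sums and
products. -/

namespace InfFree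

/-! ### Creation and annihilation operators on the full Fock space -/

section Fock

variable {R : Type*} [CommRing R] {J : Type*}

/-- The operator on the full Fock space (with basis the words in `J`) which sends a word `L` to
`j L` plus the sum over all splittings `L = L' L''` of `κ(j L') L''`. -/
noncomputable def fockOp (κ : List J → R) (j : J) : Module.End R (List J →₀ R) :=
  Finsupp.linearCombination R fun L => Finsupp.single (j :: L) (1 : R) +
    ∑ s ∈ Finset.range (L.length + 1), Finsupp.single (L.drop s) (κ (j :: L.take s))

lemma fockOp_single (κ : List J → R) (j : J) (L : List J) :
    fockOp κ j (Finsupp.single L 1) = Finsupp.single (j :: L) (1 : R) +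
      ∑ s ∈ Finset.range (L.length + 1), Finsupp.single (L.drop s) (κ (j :: L.take s)) := by
  simp [fockOp]

/-- The vacuum state. -/
noncomputable def vacuum : Module.End R (List J →₀ R) →ₗ[R] R :=
  Finsupp.lapply [] ∘ₗ LinearMap.applyₗ (Finsupp.single [] 1)

lemma vacuum_apply (T : Module.End R (List J →₀ R)) :
    vacuum T = T (Finsupp.single [] 1) [] := rfl

end Fock

/-! ### Non-crossing partitions with open positions -/

section OpenPartitions

variable {α : Type*} [LinearOrder α]

/-- `P` is a non-crossing partition of `S \ U` whose blocks do not cover any element of `U`. -/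
structure IsOpenNC (S U : Finset α) (P : Finset (Finset α)) : Prop where
  mem_iff : ∀ x, x ∈ S ↔ x ∈ U ∨ ∃ V ∈ P, x ∈ V
  notMem : ∀ V ∈ P, ∀ x ∈ V, x ∉ U
  eq_of_mem : ∀ V ∈ P, ∀ W ∈ P, ∀ x ∈ V, x ∈ W → V = W
  nonempty : ∀ V ∈ P, V.Nonempty
  noncrossing : ∀ V ∈ P, ∀ W ∈ P, ∀ a ∈ V, ∀ b ∈ W, ∀ c ∈ V, ∀ d ∈ W,
    a < b → b < c → c < d → V = W
  uncovered : ∀ V ∈ P, ∀ u ∈ U, ∀ a ∈ V, ∀ b ∈ V, a < u → ¬ u < b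

variable {S T U V : Finset α} {P : Finset (Finset α)} {j : α}

/-- The new position lies to the left of everything, so no block can cover it. This is the effect of
the creation term of `fockOp`. -/
lemma IsOpenNC.push (hj : ∀ x ∈ S, j < x) (h : IsOpenNC S U P) :
    IsOpenNC (insert j S) (insert j U) P where
  mem_iff x := by have := h.mem_iff x; grind
  notMem V hV x hx := by have := h.notMem V hV x hx; have := h.mem_iff x; grind
  eq_of_mem := h.eq_of_mem
  nonempty := h.nonempty
  noncrossing := h.noncrossing
  uncovered V hV u hu a ha b hb h1 h2 := by
    have := h.mem_iff a
    have := h.uncovered V hV u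
    grind

lemma IsOpenNC.push_inv (hj : ∀ x ∈ S, j < x) (hU : j ∈ U) (h : IsOpenNC (insert j S) U P) :
    IsOpenNC S (U.erase j) P where
  mem_iff x := by have := h.mem_iff x; have := h.notMem; grind
  notMem V hV x hx := by have := h.notMem V hV x hx; grind
  eq_of_mem := h.eq_of_mem
  nonempty := h.nonempty
  noncrossing := h.noncrossing
  uncovered V hV u hu := h.uncovered V hV u (Finset.mem_of_mem_erase hu)

/-- The effect of an annihilation term: `j` is joined with the first few open positions. A crossing
with an old block would make that block cover an element of `T`, which was open. As `T` is an
initial segment of `U`, the new block ends before the positions that stay open. -/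
lemma IsOpenNC.close (hj : ∀ x ∈ S, j < x) (h : IsOpenNC S U P) (hT : T ⊆ U)
    (hTU : ∀ x ∈ T, ∀ y ∈ U, y ∉ T → x < y) :
    IsOpenNC (insert j S) (U \ T) (insert (insert j T) P) := by
  have hU : ∀ x ∈ U, j < x := fun x hx => hj x ((h.mem_iff x).2 (Or.inl hx))
  have hP : ∀ V ∈ P, ∀ x ∈ V, j < x ∧ x ∉ U := fun V hV x hx =>
    ⟨hj x ((h.mem_iff x).2 (Or.inr ⟨V, hV, hx⟩)), h.notMem V hV x hx⟩
  refine ⟨fun x => ?_, ?_, ?_, ?_, ?_, ?_⟩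
  · have := h.mem_iff x
    simp only [Finset.mem_insert, Finset.mem_sdiff, exists_eq_or_imp, this]
    by_cases hx : x ∈ T
    · simp [hx, hT hx]
    · by_cases hx2 : x = j <;> simp [hx, hx2]
  · intro V hV x hx
    rcases Finset.mem_insert.1 hV with rfl | hV
    · grind
    · have := hP V hV x hx
      grind
  · intro V hV W hW x hx hx'
    rcases Finset.mem_insert.1 hV with rfl | hV <;> rcases Finset.mem_insert.1 hW with rfl | hW
    · rfl
    · have := hP W hW x hx'
      grind
    · have := hP V hV x hx
      grind
    · exact h.eq_of_mem V hV W hW x hx hx'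
  · intro V hV
    rcases Finset.mem_insert.1 hV with rfl | hV
    · simp
    · exact h.nonempty V hV
  · intro V hV W hW a ha b hb c hc d hd hab hbc hcd
    rcases Finset.mem_insert.1 hV with rfl | hV <;> rcases Finset.mem_insert.1 hW with rfl | hW
    · rfl
    · have h1 : c ∈ U := by
        have := hP W hW b hb
        grind
      exact absurd hcd (h.uncovered W hW c h1 b hb d hd hbc)
    · have h1 : b ∈ U := by
        have := hP V hV a ha
        grind
      exact absurd hbc (h.uncovered V hV b h1 a ha c hc hab)
    · exact h.noncrossing V hV W hW a ha b hb c hc d hd hab hbc hcd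
  · intro V hV u hu a ha b hb hau hub
    rw [Finset.mem_sdiff] at hu
    rcases Finset.mem_insert.1 hV with rfl | hV
    · have := hU u hu.1
      rcases Finset.mem_insert.1 hb with rfl | hb
      · exact absurd (hub.trans this) (lt_irrefl _)
      · exact absurd (hub.trans (hTU b hb u hu.1 hu.2)) (lt_irrefl _)
    · exact h.uncovered V hV u hu.1 a ha b hb hau hub

lemma IsOpenNC.lt_of_mem (hj : ∀ x ∈ S, j < x) (h : IsOpenNC (insert j S) U P)
    (hU : j ∉ U) (hV : V ∈ P) (hjV : j ∈ V) {x y : α} (hx : x ∈ V) (hy : y ∈ U) : x < y := by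
  have hyj : j < y := by
    have := h.mem_iff y
    grind
  have h1 := h.uncovered V hV y hy j hjV x hx hyj
  have h2 : x ≠ y := by
    have := h.notMem V hV x hx
    grind
  exact lt_of_le_of_ne (not_lt.1 h1) h2

/-- Dissolving the block of `j` frees its other elements. None of them is covered by another block
`W`: if `a < u < b` with `a`, `b` in `W`, then `j < a < u < b` would be a crossing of `V` and `W`.
-/
lemma IsOpenNC.close_inv (hj : ∀ x ∈ S, j < x) (h : IsOpenNC (insert j S) U P)
    (hU : j ∉ U) (hV : V ∈ P) (hjV : j ∈ V) : IsOpenNC S (V.erase j ∪ U) (P.erase V) := by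
  have hjS : j ∉ S := fun hh => lt_irrefl _ (hj j hh)
  have hlt : ∀ W ∈ P, W ≠ V → ∀ x ∈ W, j < x ∧ x ∉ V ∧ x ∉ U := fun W hW hne x hx => by
    have h1 := h.mem_iff x
    have h2 := h.eq_of_mem W hW V hV x hx
    have h3 := h.eq_of_mem W hW V hV j
    have h4 := h.notMem W hW x hx
    grind
  refine ⟨fun x => ?_, ?_, ?_, ?_, ?_, ?_⟩
  · have h1 := h.mem_iff x
    have h2 := fun W hW hne => hlt W hW hne x
    by_cases hx : x = j
    · subst hx
      simp only [hjS, false_iff]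
      grind
    · grind
  · intro W hW x hx
    have := hlt W (Finset.mem_of_mem_erase hW) (Finset.ne_of_mem_erase hW) x hx
    grind
  · exact fun W hW W' hW' =>
      h.eq_of_mem W (Finset.mem_of_mem_erase hW) W' (Finset.mem_of_mem_erase hW')
  · exact fun W hW => h.nonempty W (Finset.mem_of_mem_erase hW)
  · exact fun W hW W' hW' =>
      h.noncrossing W (Finset.mem_of_mem_erase hW) W' (Finset.mem_of_mem_erase hW')
  · intro W hW u hu a ha b hb hau hub
    have hWP := Finset.mem_of_mem_erase hW
    have hne := Finset.ne_of_mem_erase hW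
    rcases Finset.mem_union.1 hu with hu | hu
    · exact hne (h.noncrossing V hV W hWP j hjV a ha u (Finset.mem_of_mem_erase hu) b hb
        (hlt W hWP hne a ha).1 hau hub).symm
    · exact h.uncovered W hWP u hu a ha b hb hau hub

end OpenPartitions

/-! ### The vector produced by a product of Fock operators -/

section FockVector

variable {R : Type*} [CommRing R] {J : Type*} {α : Type*} [LinearOrder α]

/-- The word read off along a finite set of positions. -/
def subword (w : α → J) (U : Finset α) : List J := U.sort.map w

lemma length_subword (w : α → J) (U : Finset α) : (subword w U).length = U.card := by
  simp [subword]

lemma subword_insert (w : α → J) {U : Finset α} {j : α} (h : ∀ x ∈ U, j < x) :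
    subword w (insert j U) = w j :: subword w U := by
  rw [subword, Finset.sort_insert _ (fun b hb => (h b hb).le) (fun hh => lt_irrefl _ (h j hh))]
  rfl

lemma sort_eq_append {T U : Finset α} (hT : T ⊆ U)
    (hTU : ∀ x ∈ T, ∀ y ∈ U, y ∉ T → x < y) : U.sort = T.sort ++ (U \ T).sort := by
  have hnd : (T.sort ++ (U \ T).sort).Nodup := by
    rw [List.nodup_append]
    exact ⟨T.sort_nodup _, (U \ T).sort_nodup _, fun a ha b hb => by
      simp only [Finset.mem_sort, Finset.mem_sdiff] at ha hb
      exact (hTU a ha b hb.1 hb.2).ne⟩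
  have h := (List.toFinset_sort (· ≤ ·) hnd).2 (by
    rw [List.pairwise_append]
    exact ⟨T.pairwise_sort _, (U \ T).pairwise_sort _, fun a ha b hb => by
      simp only [Finset.mem_sort, Finset.mem_sdiff] at ha hb
      exact (hTU a ha b hb.1 hb.2).le⟩)
  rw [← h]
  congr 1
  ext x
  simp only [List.toFinset_append, Finset.sort_toFinset, Finset.mem_union, Finset.mem_sdiff]
  grind

/-- Initial segments of a finite set. -/
def initialSegments (U : Finset α) : Finset (Finset α) :=
  U.powerset.filter fun T => ∀ x ∈ T, ∀ y ∈ U, y ∉ T → x < y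

lemma mem_initialSegments {T U : Finset α} :
    T ∈ initialSegments U ↔ T ⊆ U ∧ ∀ x ∈ T, ∀ y ∈ U, y ∉ T → x < y := by
  simp [initialSegments]

/-- An initial segment is determined by its cardinality `s`: it consists of the first `s` elements.
This matches the partitions in `close` with the splittings in `fockOp`. -/
lemma sum_initialSegments {M : Type*} [AddCommMonoid M] (U : Finset α)
    (f : List α → List α → M) :
    ∑ T ∈ initialSegments U, f T.sort (U \ T).sort =
      ∑ s ∈ Finset.range (U.card + 1), f (U.sort.take s) (U.sort.drop s) := by
  refine Finset.sum_bij (fun T _ => T.card) ?_ ?_ ?_ ?_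
  · intro T hT
    rw [mem_initialSegments] at hT
    exact Finset.mem_range.2 (Nat.lt_succ_of_le (Finset.card_le_card hT.1))
  · intro T hT T' hT' h
    rw [mem_initialSegments] at hT hT'
    have h1 := sort_eq_append hT.1 hT.2
    rw [sort_eq_append hT'.1 hT'.2] at h1
    have h2 := (List.append_inj h1 (by simpa using h.symm)).1
    rw [← T.sort_toFinset (· ≤ ·), ← T'.sort_toFinset (· ≤ ·), h2]
  · intro s hs
    have hs : s ≤ U.card := by simpa [Nat.lt_succ_iff] using hs
    have hnd : (U.sort.take s).Nodup := (U.sort_nodup _).sublist (List.take_sublist _ _)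
    refine ⟨(U.sort.take s).toFinset, ?_, ?_⟩
    · rw [mem_initialSegments]
      refine ⟨fun x hx => ?_, fun x hx y hy hy' => ?_⟩
      · rw [List.mem_toFinset] at hx
        simpa using List.mem_of_mem_take hx
      · rw [List.mem_toFinset] at hx hy'
        have hp : U.sort.Pairwise (· ≤ ·) := U.pairwise_sort _
        have hyU : y ∈ U.sort := by simpa using hy
        rw [← List.take_append_drop s (U.sort (· ≤ ·)), List.pairwise_append] at hp
        rw [← List.take_append_drop s (U.sort (· ≤ ·)), List.mem_append] at hyU
        refine lt_of_le_of_ne (hp.2.2 x hx y (hyU.resolve_left hy')) ?_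
        rintro rfl
        exact hy' hx
    · rw [List.toFinset_card_of_nodup hnd]
      simpa using hs
  · intro T hT
    rw [mem_initialSegments] at hT
    rw [sort_eq_append hT.1 hT.2, List.take_left' (by simp), List.drop_left' (by simp)]

variable [Fintype α]

open Classical in
/-- All pairs of a set `U` of open positions and a non-crossing partition of `S \ U`. -/
noncomputable def openNC (S : Finset α) : Finset (Finset α × Finset (Finset α)) :=
  Finset.univ.filter fun q => IsOpenNC S q.1 q.2

lemma mem_openNC {S : Finset α} {q : Finset α × Finset (Finset α)} :
    q ∈ openNC S ↔ IsOpenNC S q.1 q.2 := by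
  simp [openNC]

/-- The sum over all non-crossing partitions with open positions, as a vector in Fock space. -/
noncomputable def fockVec (κ : List J → R) (w : α → J) (S : Finset α) : List J →₀ R :=
  ∑ q ∈ openNC S, Finsupp.single (subword w q.1) (∏ V ∈ q.2, κ (subword w V))

lemma fockVec_empty (κ : List J → R) (w : α → J) :
    fockVec κ w ∅ = Finsupp.single [] 1 := by
  have h : openNC (∅ : Finset α) = {(∅, ∅)} := by
    ext ⟨U, P⟩
    rw [mem_openNC, Finset.mem_singleton, Prod.mk.injEq]
    constructor
    · intro h
      have hh : ∀ x, ¬ (x ∈ U ∨ ∃ V ∈ P, x ∈ V) := fun x hx => by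
        simpa using (h.mem_iff x).2 hx
      refine ⟨Finset.eq_empty_of_forall_notMem fun x hx => hh x (Or.inl hx),
        Finset.eq_empty_of_forall_notMem fun V hV => ?_⟩
      obtain ⟨x, hx⟩ := h.nonempty V hV
      exact hh x (Or.inr ⟨V, hV, hx⟩)
    · rintro ⟨rfl, rfl⟩
      constructor <;> simp
  simp [fockVec, h, subword]

lemma sum_openNC_insert_mem {M : Type*} [AddCommMonoid M] {S : Finset α} {j : α}
    (hj : ∀ x ∈ S, j < x) (f : Finset α → Finset (Finset α) → M) :
    ∑ q ∈ (openNC (insert j S)).filter (fun q => j ∈ q.1), f q.1 q.2 =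
      ∑ q ∈ openNC S, f (insert j q.1) q.2 := by
  have hjS : j ∉ S := fun hh => lt_irrefl _ (hj j hh)
  refine Finset.sum_bij' (fun q _ => (q.1.erase j, q.2)) (fun q _ => (insert j q.1, q.2))
    ?_ ?_ ?_ ?_ ?_
  · intro q hq
    rw [Finset.mem_filter, mem_openNC] at hq
    exact mem_openNC.2 (hq.1.push_inv hj hq.2)
  · intro q hq
    rw [mem_openNC] at hq
    rw [Finset.mem_filter, mem_openNC]
    exact ⟨hq.push hj, Finset.mem_insert_self _ _⟩
  · intro q hq
    rw [Finset.mem_filter] at hq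
    simp [Finset.insert_erase hq.2]
  · intro q hq
    rw [mem_openNC] at hq
    have : j ∉ q.1 := fun h => hjS ((hq.mem_iff j).2 (Or.inl h))
    simp [Finset.erase_insert this]
  · intro q hq
    rw [Finset.mem_filter] at hq
    simp [Finset.insert_erase hq.2]

lemma sum_openNC_insert_notMem {M : Type*} [AddCommMonoid M] {S : Finset α} {j : α}
    (hj : ∀ x ∈ S, j < x) (f : Finset α → Finset (Finset α) → M) :
    ∑ q ∈ (openNC (insert j S)).filter (fun q => j ∉ q.1), f q.1 q.2 =
      ∑ q ∈ openNC S, ∑ T ∈ initialSegments q.1, f (q.1 \ T) (insert (insert j T) q.2) := by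
  have hjS : j ∉ S := fun hh => lt_irrefl _ (hj j hh)
  rw [Finset.sum_sigma']
  symm
  refine Finset.sum_bij (fun q _ => (q.1.1 \ q.2, insert (insert j q.2) q.1.2)) ?_ ?_ ?_ ?_
  · rintro ⟨q, T⟩ hq
    simp only [Finset.mem_sigma, mem_openNC, mem_initialSegments] at hq
    rw [Finset.mem_filter, mem_openNC]
    refine ⟨hq.1.close hj hq.2.1 hq.2.2, fun h => ?_⟩
    exact hjS ((hq.1.mem_iff j).2 (Or.inl (Finset.mem_sdiff.1 h).1))
  · rintro ⟨⟨U, P⟩, T⟩ hq ⟨⟨U', P'⟩, T'⟩ hq' heq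
    simp only [Finset.mem_sigma, mem_openNC, mem_initialSegments] at hq hq'
    simp only [Prod.mk.injEq] at heq
    obtain ⟨h1, h2⟩ := heq
    have hjP : ∀ V ∈ P, j ∉ V := fun V hV h => hjS ((hq.1.mem_iff j).2 (Or.inr ⟨V, hV, h⟩))
    have hjP' : ∀ V ∈ P', j ∉ V := fun V hV h => hjS ((hq'.1.mem_iff j).2 (Or.inr ⟨V, hV, h⟩))
    have hjT : j ∉ T := fun h => hjS ((hq.1.mem_iff j).2 (Or.inl (hq.2.1 h)))
    have hjT' : j ∉ T' := fun h => hjS ((hq'.1.mem_iff j).2 (Or.inl (hq'.2.1 h)))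
    -- Only one block contains `j`; it recovers `T`, and then `P` and `U`.
    have h3 : insert j T = insert j T' := by
      have : insert j T ∈ insert (insert j T') P' := h2 ▸ Finset.mem_insert_self _ _
      refine (Finset.mem_insert.1 this).resolve_right fun h => hjP' _ h (Finset.mem_insert_self _ _)
    have h4 : T = T' := by
      rw [← Finset.erase_insert hjT, h3, Finset.erase_insert hjT']
    subst h4
    have h5 : P = P' := by
      rw [← Finset.erase_insert (fun h => hjP _ h (Finset.mem_insert_self _ _)), h2,
        Finset.erase_insert (fun h => hjP' _ h (Finset.mem_insert_self _ _))]
    have h6 : U = U' := by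
      rw [← Finset.sdiff_union_of_subset hq.2.1, h1, Finset.sdiff_union_of_subset hq'.2.1]
    subst h5 h6
    rfl
  · rintro ⟨U, P⟩ hq
    rw [Finset.mem_filter, mem_openNC] at hq
    obtain ⟨h, hU⟩ := hq
    obtain ⟨V, hV, hjV⟩ := ((h.mem_iff j).1 (Finset.mem_insert_self _ _)).resolve_left hU
    have hd : Disjoint U (V.erase j) := by
      rw [Finset.disjoint_left]
      exact fun x hx hx' => h.notMem V hV x (Finset.mem_of_mem_erase hx') hx
    refine ⟨⟨(V.erase j ∪ U, P.erase V), V.erase j⟩, ?_, ?_⟩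
    · simp only [Finset.mem_sigma, mem_openNC, mem_initialSegments]
      refine ⟨h.close_inv hj hU hV hjV, Finset.subset_union_left, fun x hx y hy hy' => ?_⟩
      exact h.lt_of_mem hj hU hV hjV (Finset.mem_of_mem_erase hx)
        ((Finset.mem_union.1 hy).resolve_left hy')
    · simp only [Finset.insert_erase hjV, Finset.insert_erase hV, Prod.mk.injEq, and_true]
      rw [Finset.union_comm, Finset.union_sdiff_cancel_right hd]
  · intro q hq
    rfl

/-- In the vector for `insert j S`, either `j` is open, which is the creation term, or `j` is the
minimum of a block whose other elements were the first `s` open positions, which is the annihilation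
term for `s`. -/
lemma fockOp_fockVec (κ : List J → R) (w : α → J) {S : Finset α} {j : α}
    (hj : ∀ x ∈ S, j < x) :
    fockOp κ (w j) (fockVec κ w S) = fockVec κ w (insert j S) := by
  have hjS : j ∉ S := fun hh => lt_irrefl _ (hj j hh)
  rw [fockVec, fockVec, ← Finset.sum_filter_add_sum_filter_not (openNC (insert j S)) (fun q => j ∈ q.1),
    sum_openNC_insert_mem hj fun U P =>
      Finsupp.single (subword w U) (∏ V ∈ P, κ (subword w V)),
    sum_openNC_insert_notMem hj fun U P =>
      Finsupp.single (subword w U) (∏ V ∈ P, κ (subword w V)), ← Finset.sum_add_distrib, map_sum]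
  refine Finset.sum_congr rfl fun q hq => ?_
  rw [mem_openNC] at hq
  have hU : ∀ x ∈ q.1, j < x := fun x hx => hj x ((hq.mem_iff x).2 (Or.inl hx))
  have hjP : ∀ V ∈ q.2, j ∉ V := fun V hV h => hjS ((hq.mem_iff j).2 (Or.inr ⟨V, hV, h⟩))
  rw [← mul_one (∏ V ∈ q.2, κ (subword w V)), ← smul_eq_mul, ← Finsupp.smul_single, map_smul,
    fockOp_single, smul_add, subword_insert w hU]
  congr 1
  · rw [Finsupp.smul_single]
  have h1 : ∀ T ∈ initialSegments q.1,
      Finsupp.single (subword w (q.1 \ T)) (∏ V ∈ insert (insert j T) q.2, κ (subword w V)) =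
      (∏ V ∈ q.2, κ (subword w V)) •
        Finsupp.single ((q.1 \ T).sort.map w) (κ (w j :: T.sort.map w)) := by
    intro T hT
    rw [mem_initialSegments] at hT
    rw [Finset.prod_insert (fun h => hjP _ h (Finset.mem_insert_self _ _)),
      subword_insert w fun x hx => hU x (hT.1 hx), Finsupp.smul_single, smul_eq_mul, mul_comm]
    rfl
  rw [Finset.sum_congr rfl h1, ← Finset.smul_sum, sum_initialSegments q.1 fun A B =>
    Finsupp.single (B.map w) (κ (w j :: A.map w)), length_subword]
  simp [subword, List.map_take, List.map_drop]

/-- The rightmost operator acts first, so positions are inserted in decreasing order, as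
`fockOp_fockVec` requires. -/
lemma prod_fockOp_vacuum (κ : List J → R) (w : α → J) (l : List α) (hl : l.Pairwise (· < ·)) :
    (l.map fun x => fockOp κ (w x)).prod (Finsupp.single [] 1) = fockVec κ w l.toFinset := by
  induction l with
  | nil => simp [fockVec_empty]
  | cons j l ih =>
    rw [List.pairwise_cons] at hl
    rw [List.map_cons, List.prod_cons, Module.End.mul_apply, ih hl.2, List.toFinset_cons]
    exact fockOp_fockVec κ w fun x hx => hl.1 x (List.mem_toFinset.1 hx)

end FockVector

open Classical in
-- The coefficient of the empty word keeps the terms without open positions, which are the honest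
-- non-crossing partitions.
lemma fockVec_univ {R : Type*} [CommRing R] {J : Type*} {n : ℕ} (κ : List J → R)
    (w : Fin n → J) :
    fockVec κ w Finset.univ [] = ∑ p ∈ NC n, ∏ V ∈ p.parts, κ (subword w V) := by
  rw [fockVec, Finsupp.finsetSum_apply]
  have h0 : ∀ U : Finset (Fin n), subword w U = [] ↔ U = ∅ := fun U => by
    rw [← List.length_eq_zero_iff, length_subword, Finset.card_eq_zero]
  simp only [Finsupp.single_apply, h0]
  rw [← Finset.sum_filter]
  symm
  refine Finset.sum_bij (fun p _ => (∅, p.parts)) ?_ ?_ ?_ ?_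
  · intro p hp
    simp only [NC, Finset.mem_filter, Finset.mem_univ, true_and] at hp
    simp only [Finset.mem_filter, mem_openNC, and_true]
    refine ⟨fun x => ?_, by simp, fun V hV W hW x hx hx' => ?_,
      fun V hV => p.nonempty_of_mem_parts hV, hp, by simp⟩
    · simpa using p.exists_mem (Finset.mem_univ x)
    · exact p.eq_of_mem_parts hV hW hx hx'
  · intro p _ p' _ h
    exact Finpartition.ext (Prod.mk.inj h).2
  · rintro ⟨U, P⟩ hq
    simp only [Finset.mem_filter, mem_openNC] at hq
    obtain ⟨h, rfl⟩ := hq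
    refine ⟨⟨P, ?_, ?_, ?_⟩, ?_, rfl⟩
    · rw [Finset.supIndep_iff_pairwiseDisjoint]
      intro V hV W hW hne
      refine Finset.disjoint_left.2 fun x hx hx' => hne (h.eq_of_mem V hV W hW x hx hx')
    · ext x
      have := h.mem_iff x
      simpa [Finset.mem_sup] using this
    · intro h'
      simpa using h.nonempty _ h'
    · simp only [NC, Finset.mem_filter, Finset.mem_univ, true_and]
      exact h.noncrossing
  · intro p _
    rfl

/-- The moments of the Fock space operators are given by the moment-cumulant formula. -/
lemma vacuum_prod_fockOp {R : Type*} [CommRing R] {J : Type*} {n : ℕ} (κ : List J → R)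
    (w : Fin n → J) :
    vacuum (List.ofFn fun i => fockOp κ (w i)).prod =
      ∑ p ∈ NC n, ∏ V ∈ p.parts, κ (subword w V) := by
  rw [vacuum_apply, ← fockVec_univ, List.ofFn_eq_map, prod_fockOp_vacuum]
  · simp
  · exact List.pairwise_lt_finRange n

/-! ### Freeness of the Fock operators -/

section FockFree

variable {C ι : Type*} (κ : List (C × ι) → ℂ)

/-- The span of the words which satisfy `p`. -/
noncomputable def wordSpan {J : Type*} (p : List J → Prop) : Submodule ℂ (List J →₀ ℂ) :=
  Submodule.span ℂ ((fun L => Finsupp.single L (1 : ℂ)) '' {L | p L})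

lemma single_mem_wordSpan {J : Type*} {p : List J → Prop} {L : List J} (h : p L) (r : ℂ) :
    Finsupp.single L r ∈ wordSpan p := by
  rw [← mul_one r, ← smul_eq_mul, ← Finsupp.smul_single]
  exact Submodule.smul_mem _ _ (Submodule.subset_span ⟨L, h, rfl⟩)

lemma wordSpan_le_comap {J : Type*} {p : List J → Prop} {S : Submodule ℂ (List J →₀ ℂ)}
    {T : Module.End ℂ (List J →₀ ℂ)} (h : ∀ L, p L → T (Finsupp.single L 1) ∈ S)
    {v : List J →₀ ℂ} (hv : v ∈ wordSpan p) : T v ∈ S := by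
  have : wordSpan p ≤ S.comap T := by
    rw [wordSpan, Submodule.span_le]
    rintro _ ⟨L, hL, rfl⟩
    exact h L hL
  exact this hv

lemma eqOn_wordSpan {J : Type*} {p : List J → Prop} {T T' : Module.End ℂ (List J →₀ ℂ)}
    (h : ∀ L, p L → T (Finsupp.single L 1) = T' (Finsupp.single L 1))
    {v : List J →₀ ℂ} (hv : v ∈ wordSpan p) : T v = T' v := by
  refine LinearMap.eqOn_span (R := ℂ) ?_ hv
  rintro _ ⟨L, hL, rfl⟩
  exact h L hL

/-- Appending a word on the right. -/
noncomputable def appendRight {J : Type*} (L : List J) : Module.End ℂ (List J →₀ ℂ) :=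
  Finsupp.lmapDomain ℂ ℂ (· ++ L)

lemma appendRight_single {J : Type*} (L W : List J) (r : ℂ) :
    appendRight L (Finsupp.single W r) = Finsupp.single (W ++ L) r := by
  simp [appendRight]

variable {κ} (hκ : ∀ L, (∃ x ∈ L, ∃ y ∈ L, x.1 ≠ y.1) → κ L = 0)

include hκ in
-- A splitting that reaches into `L` has a weight whose word contains both `(c, u)` and the head of
-- `L`, which has another colour. That weight vanishes, so the operator does not see `L`.
lemma fockOp_append (c : C) (u : ι) (L : List (C × ι)) (hL : ∀ x ∈ L.head?, x.1 ≠ c)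
    (W : List (C × ι)) :
    fockOp κ (c, u) (Finsupp.single (W ++ L) 1) =
      appendRight L (fockOp κ (c, u) (Finsupp.single W 1)) := by
  rw [fockOp_single, fockOp_single, map_add, map_sum, appendRight_single]
  congr 1
  symm
  refine Finset.sum_subset_zero_on_sdiff (fun s hs => ?_) (fun s hs => ?_) (fun s hs => ?_)
  · simp only [Finset.mem_range, List.length_append] at hs ⊢
    omega
  · simp only [Finset.mem_sdiff, Finset.mem_range, List.length_append] at hs
    rw [hκ, Finsupp.single_zero]
    obtain _ | ⟨x, L⟩ := L
    · simp at hs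
      omega
    · refine ⟨x, ?_, (c, u), by simp, hL x (by simp)⟩
      rw [List.take_append, show s - W.length = (s - W.length - 1) + 1 by omega]
      simp
  · have : s ≤ W.length := by simpa [Nat.lt_succ_iff] using hs
    rw [appendRight_single, List.take_append_of_le_length this,
      List.drop_append_of_le_length this]

include hκ in
-- Invariance of the monochromatic vectors is proved together with the commutation, because the
-- induction step for products uses it.
lemma adjoin_fockOp {c : C} {T : Module.End ℂ (List (C × ι) →₀ ℂ)}
    (hT : T ∈ Algebra.adjoin ℂ (Set.range fun u => fockOp κ (c, u)))
    (L : List (C × ι)) (hL : ∀ x ∈ L.head?, x.1 ≠ c) :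
    ∀ v ∈ wordSpan fun W : List (C × ι) => ∀ x ∈ W, x.1 = c,
      T v ∈ wordSpan (fun W : List (C × ι) => ∀ x ∈ W, x.1 = c) ∧
        T (appendRight L v) = appendRight L (T v) := by
  induction hT using Algebra.adjoin_induction with
  | mem T hT =>
    obtain ⟨u, rfl⟩ := hT
    refine fun v hv => ⟨wordSpan_le_comap (fun W hW => ?_) hv,
      eqOn_wordSpan (T := fockOp κ (c, u) ∘ₗ appendRight L)
        (T' := appendRight L ∘ₗ fockOp κ (c, u)) (fun W _ => ?_) hv⟩
    · rw [fockOp_single]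
      refine Submodule.add_mem _ (single_mem_wordSpan (by simpa using hW) _)
        (Submodule.sum_mem _ fun s _ => single_mem_wordSpan (fun x hx => ?_) _)
      exact hW x (List.mem_of_mem_drop hx)
    · rw [LinearMap.comp_apply, appendRight_single, fockOp_append hκ c u L hL,
        LinearMap.comp_apply]
  | algebraMap r =>
    intro v hv
    simp only [Module.algebraMap_end_apply, map_smul]
    exact ⟨Submodule.smul_mem _ _ hv, trivial⟩
  | add S T _ _ hS hT =>
    intro v hv
    simp only [LinearMap.add_apply, map_add, (hS v hv).2, (hT v hv).2]
    exact ⟨Submodule.add_mem _ (hS v hv).1 (hT v hv).1, trivial⟩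
  | mul S T _ _ hS hT =>
    intro v hv
    simp only [Module.End.mul_apply, (hT v hv).2]
    exact hS _ (hT v hv).1

include hκ in
-- Applying `T` to `L` amounts to appending `L` to `T` applied to the vacuum vector. The latter is
-- monochromatic, and its coefficient at the empty word is `vacuum T = 0`.
lemma adjoin_fockOp_centered {c : C} {T : Module.End ℂ (List (C × ι) →₀ ℂ)}
    (hT : T ∈ Algebra.adjoin ℂ (Set.range fun u => fockOp κ (c, u))) (h0 : vacuum T = 0)
    (L : List (C × ι)) (hL : ∀ x ∈ L.head?, x.1 ≠ c) :
    T (Finsupp.single L 1) ∈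
      wordSpan fun W : List (C × ι) => W ≠ [] ∧ ∀ x ∈ W.head?, x.1 = c := by
  obtain ⟨h1, h2⟩ := adjoin_fockOp hκ hT L hL (Finsupp.single [] 1)
    (single_mem_wordSpan (by simp) _)
  rw [appendRight_single, List.nil_append] at h2
  rw [h2]
  have h3 : T (Finsupp.single [] 1) ∈
      wordSpan fun W : List (C × ι) => W ≠ [] ∧ ∀ x ∈ W, x.1 = c := by
    rw [wordSpan, ← Finsupp.supported_eq_span_single, Finsupp.mem_supported] at h1 ⊢
    intro W hW
    refine ⟨?_, h1 hW⟩
    rintro rfl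
    exact (Finsupp.mem_support_iff.1 hW) h0
  refine wordSpan_le_comap (fun W hW => ?_) h3
  rw [appendRight_single]
  refine single_mem_wordSpan ?_ _
  obtain _ | ⟨x, W⟩ := W
  · exact absurd rfl hW.1
  · simpa using hW.2 x (by simp)

include hκ in
/-- The Fock space operators with vanishing mixed `κ` are free. -/
theorem free_vacuum :
    Free (vacuum (R := ℂ) (J := C × ι)) fun c => Set.range fun u => fockOp κ (c, u) := by
  have key : ∀ (n : ℕ) (a : Fin (n + 1) → Module.End ℂ (List (C × ι) →₀ ℂ))
      (c : Fin (n + 1) → C),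
      (∀ j, a j ∈ Algebra.adjoin ℂ (Set.range fun u => fockOp κ (c j, u))) →
      (∀ j, vacuum (a j) = 0) →
      (∀ j j' : Fin (n + 1), (j : ℕ) + 1 = j' → c j ≠ c j') →
      (List.ofFn a).prod (Finsupp.single [] 1) ∈
        wordSpan fun W : List (C × ι) => W ≠ [] ∧ ∀ x ∈ W.head?, x.1 = c 0 := by
    intro n
    induction n with
    | zero =>
      intro a c ha h0 _
      simpa using adjoin_fockOp_centered hκ (ha 0) (h0 0) [] (by simp)
    | succ n ih =>
      intro a c ha h0 hc
      have h1 := ih (fun j => a j.succ) (fun j => c j.succ) (fun j => ha _) (fun j => h0 _)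
        (fun j j' h => hc _ _ (by simpa using h))
      rw [List.ofFn_succ, List.prod_cons, Module.End.mul_apply]
      -- The words produced so far begin with the colour of the second factor, which differs from
      -- that of the first, so the first factor leaves them intact and prepends its own colour.
      refine wordSpan_le_comap (fun W hW => ?_) h1
      refine adjoin_fockOp_centered hκ (ha 0) (h0 0) W fun x hx => ?_
      rw [hW.2 x hx]
      exact (hc 0 (Fin.succ 0) (by simp)).symm
  intro n a c hn ha h0 hc
  obtain _ | n := n
  · omega
  · have h := key n a c ha h0 hc
    rw [wordSpan, ← Finsupp.supported_eq_span_single, Finsupp.mem_supported] at h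
    rw [vacuum_apply]
    by_contra hne
    exact (h (Finsupp.mem_support_iff.2 hne)).1 rfl

end FockFree

/-! ### Uniqueness of the joint distribution of free tuples -/

section FreeUnique

variable {C ι : Type*}

/-- The subalgebra of the free algebra generated by the variables of one colour. -/
abbrev colourSubalgebra (c : C) : Subalgebra ℂ (FreeAlgebra ℂ (C × ι)) :=
  Algebra.adjoin ℂ (Set.range fun u => FreeAlgebra.ι ℂ (c, u))

/-- Alternating lists of centered elements of the free algebra. -/
structure IsAlternatingCentered (ψ : FreeAlgebra ℂ (C × ι) →ₗ[ℂ] ℂ)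
    (l : List (C × FreeAlgebra ℂ (C × ι))) : Prop where
  mem : ∀ p ∈ l, p.2 ∈ colourSubalgebra p.1
  centered : ∀ p ∈ l, ψ p.2 = 0
  alternating : l.IsChain fun p q => p.1 ≠ q.1

/-- The span of the alternating products of centered elements. -/
def alternatingSpan (ψ : FreeAlgebra ℂ (C × ι) →ₗ[ℂ] ℂ) :
    Submodule ℂ (FreeAlgebra ℂ (C × ι)) :=
  Submodule.span ℂ {P | ∃ l, IsAlternatingCentered ψ l ∧ (l.map Prod.snd).prod = P}

variable {ψ : FreeAlgebra ℂ (C × ι) →ₗ[ℂ] ℂ}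

/-- Split `q` into its centered part and the scalar `ψ q`. -/
lemma mul_mem_alternatingSpan (hψ : ψ 1 = 1) {c : C} {q : FreeAlgebra ℂ (C × ι)}
    (hq : q ∈ colourSubalgebra c) {l : List (C × FreeAlgebra ℂ (C × ι))}
    (hl : IsAlternatingCentered ψ l) (hc : ∀ p ∈ l.head?, c ≠ p.1) :
    q * (l.map Prod.snd).prod ∈ alternatingSpan ψ := by
  have h1 : IsAlternatingCentered ψ ((c, q - algebraMap ℂ _ (ψ q)) :: l) := by
    refine ⟨?_, ?_, ?_⟩
    · rintro p hp
      rcases List.mem_cons.1 hp with rfl | hp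
      · exact Subalgebra.sub_mem _ hq (Subalgebra.algebraMap_mem _ _)
      · exact hl.mem p hp
    · rintro p hp
      rcases List.mem_cons.1 hp with rfl | hp
      · simp [Algebra.algebraMap_eq_smul_one, hψ]
      · exact hl.centered p hp
    · rw [List.isChain_cons]
      exact ⟨hc, hl.alternating⟩
  have h2 : q * (l.map Prod.snd).prod =
      (((c, q - algebraMap ℂ _ (ψ q)) :: l).map Prod.snd).prod +
        ψ q • (l.map Prod.snd).prod := by
    simp [Algebra.algebraMap_eq_smul_one, sub_mul]
  rw [h2]
  exact Submodule.add_mem _ (Submodule.subset_span ⟨_, h1, rfl⟩)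
    (Submodule.smul_mem _ _ (Submodule.subset_span ⟨_, hl, rfl⟩))

lemma generator_mul_mem_alternatingSpan (hψ : ψ 1 = 1) (x : C × ι)
    {Q : FreeAlgebra ℂ (C × ι)} (hQ : Q ∈ alternatingSpan ψ) :
    FreeAlgebra.ι ℂ x * Q ∈ alternatingSpan ψ := by
  have hx : FreeAlgebra.ι ℂ x ∈ colourSubalgebra x.1 := Algebra.subset_adjoin ⟨x.2, rfl⟩
  have : alternatingSpan ψ ≤
      (alternatingSpan ψ).comap (LinearMap.mulLeft ℂ (FreeAlgebra.ι ℂ x)) := by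
    conv_lhs => rw [alternatingSpan]
    rw [Submodule.span_le]
    rintro _ ⟨l, hl, rfl⟩
    simp only [Submodule.comap_coe, Set.mem_preimage, LinearMap.mulLeft_apply, SetLike.mem_coe]
    by_cases hc : ∀ p ∈ l.head?, x.1 ≠ p.1
    · exact mul_mem_alternatingSpan hψ hx hl hc
    · obtain _ | ⟨p, l⟩ := l
      · simp at hc
      · simp only [List.head?_cons, Option.mem_some_iff, forall_eq', not_not] at hc
        -- If the colours agree, the generator is absorbed into the first factor, which is then
        -- centered again.
        rw [List.map_cons, List.prod_cons, ← mul_assoc]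
        have h2 := List.isChain_cons.1 hl.alternating
        refine mul_mem_alternatingSpan hψ
          (Subalgebra.mul_mem _ (hc ▸ hx) (hl.mem p (by simp)))
          ⟨fun q hq => hl.mem q (List.mem_cons_of_mem _ hq),
            fun q hq => hl.centered q (List.mem_cons_of_mem _ hq), h2.2⟩ h2.1
  exact this hQ

/-- The span contains `1`, the empty product, and is stable under left multiplication by generators.
-/
lemma alternatingSpan_eq_top (hψ : ψ 1 = 1) : alternatingSpan ψ = ⊤ := by
  have key : ∀ P : FreeAlgebra ℂ (C × ι), ∀ Q ∈ alternatingSpan ψ, P * Q ∈ alternatingSpan ψ := by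
    intro P
    induction P using FreeAlgebra.induction with
    | grade0 r =>
      intro Q hQ
      rw [← Algebra.smul_def]
      exact Submodule.smul_mem _ _ hQ
    | grade1 x => exact fun Q hQ => generator_mul_mem_alternatingSpan hψ x hQ
    | mul P P' h h' =>
      intro Q hQ
      rw [mul_assoc]
      exact h _ (h' Q hQ)
    | add P P' h h' =>
      intro Q hQ
      rw [add_mul]
      exact Submodule.add_mem _ (h Q hQ) (h' Q hQ)
  rw [eq_top_iff]
  intro P _
  rw [← mul_one P]
  exact key P 1 (Submodule.subset_span ⟨[], ⟨by simp, by simp, by simp⟩, by simp⟩)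

variable {m : ℕ} {A A' : Type*} [Ring A] [Algebra ℂ A] [Ring A'] [Algebra ℂ A']

lemma lift_mem_adjoin (x : C × ι → A) {c : C} {P : FreeAlgebra ℂ (C × ι)}
    (hP : P ∈ colourSubalgebra c) :
    FreeAlgebra.lift ℂ x P ∈ Algebra.adjoin ℂ (Set.range fun u => x (c, u)) := by
  have h : FreeAlgebra.lift ℂ x P ∈ (colourSubalgebra (ι := ι) c).map (FreeAlgebra.lift ℂ x) :=
    ⟨P, hP, rfl⟩
  rw [AlgHom.map_adjoin, ← Set.range_comp] at h
  simpa [Function.comp_def] using h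

lemma lift_lift_colour (x : C × ι → A) (c : C) (Q : FreeAlgebra ℂ ι) :
    FreeAlgebra.lift ℂ x (FreeAlgebra.lift ℂ (fun u => FreeAlgebra.ι ℂ (c, u)) Q) =
      FreeAlgebra.lift ℂ (fun u => x (c, u)) Q := by
  rw [← AlgHom.comp_apply]
  congr 1
  ext u
  simp

lemma apply_lift_of_mem_colourSubalgebra (φ : A →ₗ[ℂ] ℂ) (φ' : A' →ₗ[ℂ] ℂ)
    (x : C × Fin m → A) (x' : C × Fin m → A')
    (hd : ∀ c, distr φ (fun u => x (c, u)) = distr φ' (fun u => x' (c, u)))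
    {c : C} {P : FreeAlgebra ℂ (C × Fin m)} (hP : P ∈ colourSubalgebra c) :
    φ (FreeAlgebra.lift ℂ x P) = φ' (FreeAlgebra.lift ℂ x' P) := by
  rw [colourSubalgebra, Algebra.adjoin_range_eq_range_freeAlgebra_lift] at hP
  obtain ⟨Q, rfl⟩ := hP
  have := LinearMap.congr_fun (hd c) Q
  simp only [distr, LinearMap.comp_apply, AlgHom.toLinearMap_apply] at this
  rw [AlgHom.toRingHom_eq_coe, RingHom.coe_coe, lift_lift_colour, lift_lift_colour, this]

lemma Free.apply_alternating {φ : A →ₗ[ℂ] ℂ} {x : C × ι → A}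
    (hf : Free φ fun c => Set.range fun u => x (c, u))
    {l : List (C × FreeAlgebra ℂ (C × ι))} (hne : l ≠ [])
    (hl : IsAlternatingCentered (φ ∘ₗ (FreeAlgebra.lift ℂ x).toLinearMap) l) :
    φ (FreeAlgebra.lift ℂ x (l.map Prod.snd).prod) = 0 := by
  have h := hf l.length (fun j => FreeAlgebra.lift ℂ x (l.get j).2) (fun j => (l.get j).1)
    (List.length_pos_iff.2 hne) (fun j => lift_mem_adjoin x (hl.mem _ (List.get_mem _ _)))
    (fun j => hl.centered _ (List.get_mem _ _)) ?_
  · rw [map_list_prod, List.map_map]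
    rw [← h]
    congr 2
    refine List.ext_get (by simp) ?_
    intro n h1 h2
    simp
  · intro j j' hjj'
    have h3 := List.isChain_iff_getElem.1 hl.alternating j (by omega)
    simpa [hjj'] using h3

/-- The joint distribution of free tuples is determined by their distributions. -/
theorem Free.unique {φ : A →ₗ[ℂ] ℂ} {φ' : A' →ₗ[ℂ] ℂ} (hφ : φ 1 = 1) (hφ' : φ' 1 = 1)
    {x : C × Fin m → A} {x' : C × Fin m → A'}
    (hf : Free φ fun c => Set.range fun u => x (c, u))
    (hf' : Free φ' fun c => Set.range fun u => x' (c, u))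
    (hd : ∀ c, distr φ (fun u => x (c, u)) = distr φ' (fun u => x' (c, u))) :
    φ ∘ₗ (FreeAlgebra.lift ℂ x).toLinearMap = φ' ∘ₗ (FreeAlgebra.lift ℂ x').toLinearMap := by
  have htop := alternatingSpan_eq_top (ψ := φ ∘ₗ (FreeAlgebra.lift ℂ x).toLinearMap)
    (by simpa using hφ)
  refine LinearMap.ext_on htop ?_
  rintro _ ⟨l, hl, rfl⟩
  by_cases hne : l = []
  · subst hne
    simp [hφ, hφ']
  · simp only [LinearMap.comp_apply, AlgHom.toLinearMap_apply]
    rw [hf.apply_alternating hne hl, hf'.apply_alternating hne]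
    -- Each factor has one colour, so its centering depends only on the common marginal
    -- distributions.
    refine ⟨hl.mem, fun p hp => ?_, hl.alternating⟩
    rw [← hl.centered p hp]
    exact (apply_lift_of_mem_colourSubalgebra φ φ' x x' hd (hl.mem p hp)).symm

end FreeUnique

/-! ### The moment-cumulant formula for weights on words -/

section NCSum

variable {J : Type*} {k n : ℕ}

/-- The contribution of a partition to the infinitesimal moment-cumulant formula. -/
def blockSum (κ : Fin (k + 1) → List J → ℂ) (w : Fin n → J) (i : Fin (k + 1))
    (p : Finpartition (Finset.univ : Finset (Fin n))) : ℂ :=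
  ∑ l ∈ Lam (β := p.parts) i, multi l * ∏ V : p.parts, κ (l V) (subword w V.1)

/-- The right-hand side of the infinitesimal moment-cumulant formula. -/
noncomputable def ncSum (κ : Fin (k + 1) → List J → ℂ) (w : Fin n → J) (i : Fin (k + 1)) : ℂ :=
  ∑ p ∈ NC n, blockSum κ w i p

lemma ofFn_restrict (w : Fin n → J) (V : Finset (Fin n)) :
    List.ofFn (restrict w V) = subword w V := by
  rw [subword, ← Finset.listMap_orderEmbOfFin_finRange V rfl, List.map_map, List.ofFn_eq_map]
  rfl

lemma subword_univ (w : Fin n → J) : subword w Finset.univ = List.ofFn w := by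
  rw [subword, Fin.sort_univ, List.ofFn_eq_map]

lemma subword_ne_nil {w : Fin n → J} {V : Finset (Fin n)} (hV : V.Nonempty) :
    subword w V ≠ [] := by
  rw [Ne, ← List.length_eq_zero_iff, length_subword, Finset.card_eq_zero]
  exact hV.ne_empty

lemma blockSum_congr {J' : Type*} {κ : Fin (k + 1) → List J → ℂ}
    {κ' : Fin (k + 1) → List J' → ℂ} {w : Fin n → J} {w' : Fin n → J'}
    {p : Finpartition (Finset.univ : Finset (Fin n))}
    (h : ∀ V ∈ p.parts, ∀ i, κ i (subword w V) = κ' i (subword w' V)) (i : Fin (k + 1)) :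
    blockSum κ w i p = blockSum κ' w' i p := by
  refine Finset.sum_congr rfl fun l _ => ?_
  congr 1
  exact Finset.prod_congr rfl fun V _ => h V.1 V.2 _

lemma ncSum_congr {J' : Type*} {κ : Fin (k + 1) → List J → ℂ}
    {κ' : Fin (k + 1) → List J' → ℂ} {w : Fin n → J} {w' : Fin n → J'}
    (h : ∀ V : Finset (Fin n), V.Nonempty → ∀ i, κ i (subword w V) = κ' i (subword w' V))
    (i : Fin (k + 1)) : ncSum κ w i = ncSum κ' w' i :=
  Finset.sum_congr rfl fun p _ =>
    blockSum_congr (fun V hV => h V (p.nonempty_of_mem_parts hV)) i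

lemma parts_eq_singleton_univ {p : Finpartition (Finset.univ : Finset (Fin n))}
    (hp : Finset.univ ∈ p.parts) : p.parts = {Finset.univ} := by
  obtain ⟨x, hx⟩ := p.nonempty_of_mem_parts hp
  ext V
  rw [Finset.mem_singleton]
  constructor
  · intro hV
    obtain ⟨y, hy⟩ := p.nonempty_of_mem_parts hV
    exact p.eq_of_mem_parts hV hp hy (Finset.mem_univ y)
  · rintro rfl
    exact hp

lemma blockSum_of_univ_mem (κ : Fin (k + 1) → List J → ℂ) (w : Fin n → J) (i : Fin (k + 1))
    {p : Finpartition (Finset.univ : Finset (Fin n))} (hp : Finset.univ ∈ p.parts) :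
    blockSum κ w i p = κ i (List.ofFn w) := by
  have huniv : (Finset.univ : Finset p.parts) = {⟨Finset.univ, hp⟩} := by
    ext V
    have : V.1 = Finset.univ := by simpa [parts_eq_singleton_univ hp] using V.2
    simpa using Subtype.ext this
  have hL : Lam (β := p.parts) i = {fun _ => i} := by
    ext l
    simp only [Lam, huniv, Finset.mem_filter, Finset.mem_univ, true_and,
      Finset.sum_singleton, Finset.mem_singleton]
    constructor
    · intro h
      funext V
      have hV := Finset.mem_univ V
      rw [huniv, Finset.mem_singleton] at hV
      rw [hV]
      exact Fin.ext h
    · rintro rfl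
      rfl
  rw [blockSum, hL, Finset.sum_singleton, huniv, Finset.prod_singleton, subword_univ]
  simp [multi, huniv]

/-- The infinitesimal moment-cumulant formula with the one-block partition split off. -/
lemma ncSum_eq_add (κ : Fin (k + 1) → List J → ℂ) (w : Fin n → J) (hn : n ≠ 0)
    (i : Fin (k + 1)) :
    ncSum κ w i = κ i (List.ofFn w) +
      ∑ p ∈ (NC n).filter (fun p => Finset.univ ∉ p.parts), blockSum κ w i p := by
  have hne : (Finset.univ : Finset (Fin n)).Nonempty :=
    ⟨⟨0, Nat.pos_of_ne_zero hn⟩, Finset.mem_univ _⟩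
  have hp0 : ((NC n).filter fun p => Finset.univ ∈ p.parts) =
      {Finpartition.indiscrete hne.ne_empty} := by
    ext p
    simp only [Finset.mem_filter, Finset.mem_singleton]
    constructor
    · rintro ⟨-, h⟩
      exact Finpartition.ext (by simpa using parts_eq_singleton_univ h)
    · rintro rfl
      refine ⟨?_, by simp⟩
      simp only [NC, Finset.mem_filter, Finset.mem_univ, true_and]
      intro V hV W hW
      simp_all
  rw [ncSum, ← Finset.sum_filter_add_sum_filter_not (NC n) (fun p => Finset.univ ∈ p.parts),
    hp0, Finset.sum_singleton, blockSum_of_univ_mem κ w i (by simp)]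

/-- Cumulants are determined by the moments. -/
lemma eq_of_ncSum_eq {κ κ' : Fin (k + 1) → List J → ℂ}
    (h : ∀ (n : ℕ) (w : Fin n → J) i, ncSum κ w i = ncSum κ' w i) (L : List J) (hL : L ≠ [])
    (i : Fin (k + 1)) : κ i L = κ' i L := by
  induction hN : L.length using Nat.strong_induction_on generalizing L i with
  | _ N ih =>
    have hN0 : L.length ≠ 0 := fun h0 => hL (List.length_eq_zero_iff.1 h0)
    have h1 := h L.length L.get i
    rw [ncSum_eq_add κ _ hN0, ncSum_eq_add κ' _ hN0, List.ofFn_get] at h1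
    refine add_right_cancel (h1.trans (congrArg _ ?_))
    -- Without the one-block partition, all blocks give words shorter than `L`, where the two
    -- families agree by induction.
    refine Finset.sum_congr rfl fun p hp => blockSum_congr (fun V hV i => ?_) i
    refine (ih _ ?_ _ (subword_ne_nil (p.nonempty_of_mem_parts hV)) i rfl).symm
    rw [length_subword, ← hN]
    refine card_lt_of_ne_univ V ?_
    rintro rfl
    exact (Finset.mem_filter.1 hp).2 hV

/-- The empty partition has only the empty family of orders, of sum `0`. This is the normalisation
of `IsInfState`, so for such functionals the formula also holds in length zero. -/
lemma ncSum_zero_length (κ : Fin (k + 1) → List J → ℂ) (w : Fin 0 → J) (i : Fin (k + 1)) :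
    ncSum κ w i = if i = 0 then 1 else 0 := by
  have hE : ∀ p : Finpartition (Finset.univ : Finset (Fin 0)), p.parts = ∅ := fun p =>
    Finset.eq_empty_of_forall_notMem fun V hV =>
      (p.nonempty_of_mem_parts hV).elim fun x _ => x.elim0
  have h1 : NC 0 = {⊥} := by
    ext p
    have : p = ⊥ := Finpartition.ext ((hE p).trans (hE ⊥).symm)
    subst this
    simp only [NC, Finset.mem_filter, Finset.mem_univ, true_and, Finset.mem_singleton, iff_true]
    intro V _ W _ a
    exact a.elim0
  have h2 : IsEmpty (⊥ : Finpartition (Finset.univ : Finset (Fin 0))).parts := by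
    rw [Finset.isEmpty_coe_sort]
    exact hE _
  rw [ncSum, h1, Finset.sum_singleton, blockSum]
  by_cases hi : i = 0
  · subst hi
    simp [Lam, multi]
  · have : Lam (β := (⊥ : Finpartition (Finset.univ : Finset (Fin 0))).parts) i = ∅ := by
      rw [Lam, Finset.filter_eq_empty_iff]
      intro l _ hl
      exact hi (Fin.ext (by simpa using hl.symm))
    rw [this]
    simp [hi]

lemma blockSum_zero (κ : Fin (k + 1) → List J → ℂ) (w : Fin n → J)
    (p : Finpartition (Finset.univ : Finset (Fin n))) :
    blockSum κ w 0 p = ∏ V ∈ p.parts, κ 0 (subword w V) := by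
  have h : Lam (β := p.parts) (0 : Fin (k + 1)) = {fun _ => 0} := by
    ext l
    simp only [Lam, Finset.mem_filter, Finset.mem_univ, true_and, Finset.mem_singleton,
      Fin.val_zero, Finset.sum_eq_zero_iff, forall_const]
    constructor
    · intro h
      funext V
      exact Fin.ext (h V)
    · rintro rfl V
      rfl
  rw [blockSum, h, Finset.sum_singleton, ← Finset.prod_coe_sort p.parts]
  simp [multi, Nat.multinomial]

end NCSum

/-! ### Cumulants indexed by words -/

section WordCumulant

variable {A : Type*} [Ring A] [Algebra ℂ A] {J : Type*} {k : ℕ}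

/-- The cumulants of a family of elements, indexed by words. -/
noncomputable def wordCumulant (φ : Fin (k + 1) → (A →ₗ[ℂ] ℂ)) (x : J → A) (i : Fin (k + 1)) (L : List J) : ℂ :=
  cumulant φ L.length i fun j => x (L.get j)

lemma wordCumulant_ofFn (φ : Fin (k + 1) → (A →ₗ[ℂ] ℂ)) (x : J → A) (i : Fin (k + 1)) {n : ℕ}
    (w : Fin n → J) : wordCumulant φ x i (List.ofFn w) = cumulant φ n i fun j => x (w j) := by
  have key : ∀ (N : ℕ) (v : Fin N → J) (h : N = n), (∀ j, v j = w (Fin.cast h j)) →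
      cumulant φ N i (fun j => x (v j)) = cumulant φ n i fun j => x (w j) := by
    intro N v h hv
    subst h
    simp [hv]
  exact key _ _ (by simp) fun j => by
    simp only [List.get_ofFn]

/-- No normalisation is needed in positive length. This matters for `μ t`, which is normalised only
for `t ∈ K`. -/
lemma ncSum_wordCumulant_of_ne_zero (φ : Fin (k + 1) → (A →ₗ[ℂ] ℂ)) (x : J → A)
    {n : ℕ} (hn : n ≠ 0) (w : Fin n → J) (i : Fin (k + 1)) :
    ncSum (wordCumulant φ x) w i = φ i (List.ofFn fun j => x (w j)).prod := by
  rw [← moment_cumulant φ (Nat.pos_of_ne_zero hn)]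
  refine Finset.sum_congr rfl fun p _ => Finset.sum_congr rfl fun l _ => ?_
  congr 1
  refine Finset.prod_congr rfl fun V _ => ?_
  rw [← ofFn_restrict, wordCumulant_ofFn]
  rfl

lemma ncSum_wordCumulant {φ : Fin (k + 1) → (A →ₗ[ℂ] ℂ)} (hφ : IsInfState φ) (x : J → A)
    {n : ℕ} (w : Fin n → J) (i : Fin (k + 1)) :
    ncSum (wordCumulant φ x) w i = φ i (List.ofFn fun j => x (w j)).prod := by
  obtain _ | n := n
  · rw [ncSum_zero_length]
    simpa using (hφ i).symm
  · exact ncSum_wordCumulant_of_ne_zero φ x n.succ_ne_zero w i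

/-- Cumulants only depend on the distribution. -/
lemma wordCumulant_eq {A' : Type*} [Ring A'] [Algebra ℂ A'] {φ : Fin (k + 1) → (A →ₗ[ℂ] ℂ)}
    {φ' : Fin (k + 1) → (A' →ₗ[ℂ] ℂ)} (hφ : IsInfState φ) (hφ' : IsInfState φ') {x : J → A}
    {x' : J → A'} (h : ∀ (L : List J) i, φ i (L.map x).prod = φ' i (L.map x').prod)
    {L : List J} (hL : L ≠ []) (i : Fin (k + 1)) :
    wordCumulant φ x i L = wordCumulant φ' x' i L := by
  refine eq_of_ncSum_eq (fun n w i => ?_) L hL i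
  rw [ncSum_wordCumulant hφ, ncSum_wordCumulant hφ']
  simpa [Function.comp_def] using h (List.ofFn w) i

end WordCumulant

/-! ### Functionals on the free algebra given by values on words -/

section WordFunctional

variable {J : Type*}

lemma basisFreeMonoid_apply (L : FreeMonoid J) :
    FreeAlgebra.basisFreeMonoid ℂ J L = (L.toList.map (FreeAlgebra.ι ℂ)).prod := by
  simp [FreeAlgebra.basisFreeMonoid, FreeAlgebra.equivMonoidAlgebraFreeMonoid,
    FreeMonoid.lift_apply]

/-- The linear functional on the free algebra with given values on words. -/
noncomputable def wordFunctional (f : List J → ℂ) : FreeAlgebra ℂ J →ₗ[ℂ] ℂ :=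
  (FreeAlgebra.basisFreeMonoid ℂ J).constr ℂ fun L => f L.toList

lemma wordFunctional_prod (f : List J → ℂ) (L : List J) :
    wordFunctional f (L.map (FreeAlgebra.ι ℂ)).prod = f L := by
  have := basisFreeMonoid_apply (FreeMonoid.ofList L)
  rw [FreeMonoid.toList_ofList] at this
  rw [← this, wordFunctional, Module.Basis.constr_basis, FreeMonoid.toList_ofList]

lemma functional_ext {f g : FreeAlgebra ℂ J →ₗ[ℂ] ℂ}
    (h : ∀ L : List J, f (L.map (FreeAlgebra.ι ℂ)).prod = g (L.map (FreeAlgebra.ι ℂ)).prod) :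
    f = g := by
  refine (FreeAlgebra.basisFreeMonoid ℂ J).ext fun L => ?_
  rw [basisFreeMonoid_apply]
  exact h _

end WordFunctional

/-! ### Joint distributions with vanishing mixed cumulants -/

section Joint

variable {C : Type*} [Fintype C] [DecidableEq C] {k m : ℕ}

/-- The family of cumulants for words in several colours with vanishing mixed cumulants. -/
def mixCumulant {ι : Type*} (κ : C → Fin (k + 1) → List ι → ℂ) (i : Fin (k + 1))
    (L : List (C × ι)) : ℂ :=
  ∑ c, if ∀ x ∈ L, x.1 = c then κ c i (L.map Prod.snd) else 0

lemma mixCumulant_of_ne {ι : Type*} (κ : C → Fin (k + 1) → List ι → ℂ) (i : Fin (k + 1))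
    {L : List (C × ι)} (hL : ∃ x ∈ L, ∃ y ∈ L, x.1 ≠ y.1) : mixCumulant κ i L = 0 := by
  obtain ⟨x, hx, y, hy, hxy⟩ := hL
  exact Finset.sum_eq_zero fun c _ => if_neg fun h => hxy ((h x hx).trans (h y hy).symm)

/-- The empty word has to be excluded, being monochromatic in every colour. It never occurs as a
block. -/
lemma mixCumulant_map {ι : Type*} (κ : C → Fin (k + 1) → List ι → ℂ) (i : Fin (k + 1)) (c : C)
    {L : List ι} (hL : L ≠ []) : mixCumulant κ i (L.map fun u => (c, u)) = κ c i L := by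
  obtain ⟨u, L, rfl⟩ := List.exists_cons_of_ne_nil hL
  rw [mixCumulant, Finset.sum_eq_single c]
  · simp [Function.comp_def]
  · intro c' _ hc'
    refine if_neg fun h => hc' ?_
    exact (h (c, u) (by simp)).symm
  · simp

variable (μ : C → Fin (k + 1) → (FreeAlgebra ℂ (Fin m) →ₗ[ℂ] ℂ))

/-- The cumulants of the joint distribution of (infinitesimally) free tuples. -/
noncomputable def jointCumulant (i : Fin (k + 1)) (L : List (C × Fin m)) : ℂ :=
  mixCumulant (fun c => wordCumulant (μ c) (FreeAlgebra.ι ℂ)) i L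

/-- The joint distribution of (infinitesimally) free tuples with given distributions. -/
noncomputable def jointDistr (i : Fin (k + 1)) : FreeAlgebra ℂ (C × Fin m) →ₗ[ℂ] ℂ :=
  wordFunctional fun L => ncSum (jointCumulant μ) L.get i

lemma ofFn_comp_get {J B : Type*} (f : J → B) (L : List J) :
    (List.ofFn fun j => f (L.get j)) = L.map f := by
  conv_rhs => rw [← List.ofFn_get L, List.map_ofFn]
  rfl

lemma ncSum_ofFn_get {J : Type*} (κ : Fin (k + 1) → List J → ℂ) {n : ℕ} (w : Fin n → J)
    (i : Fin (k + 1)) : ncSum κ (List.ofFn w).get i = ncSum κ w i := by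
  have key : ∀ (N : ℕ) (v : Fin N → J) (h : N = n), (∀ j, v j = w (Fin.cast h j)) →
      ncSum κ v i = ncSum κ w i := by
    intro N v h hv
    subst h
    have : v = w := funext hv
    rw [this]
  exact key _ _ (by simp) fun j => by simp only [List.get_ofFn]

lemma jointDistr_prod (L : List (C × Fin m)) (i : Fin (k + 1)) :
    jointDistr μ i (L.map (FreeAlgebra.ι ℂ)).prod = ncSum (jointCumulant μ) L.get i :=
  wordFunctional_prod _ _

lemma jointDistr_ofFn {n : ℕ} (w : Fin n → C × Fin m) (i : Fin (k + 1)) :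
    jointDistr μ i (List.ofFn fun j => FreeAlgebra.ι ℂ (w j)).prod =
      ncSum (jointCumulant μ) w i := by
  have := jointDistr_prod μ (List.ofFn w) i
  rw [ncSum_ofFn_get, List.map_ofFn] at this
  exact this

lemma isInfState_jointDistr : IsInfState (jointDistr μ) := fun i => by
  have := jointDistr_prod μ [] i
  rw [ncSum_zero_length] at this
  simpa using this

/-- `jointDistr` is built so that its moments come from `jointCumulant`, and moments determine
cumulants. -/
lemma wordCumulant_jointDistr {L : List (C × Fin m)} (hL : L ≠ []) (i : Fin (k + 1)) :
    wordCumulant (jointDistr μ) (FreeAlgebra.ι ℂ) i L = jointCumulant μ i L := by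
  refine eq_of_ncSum_eq (fun n w i => ?_) L hL i
  rw [ncSum_wordCumulant (isInfState_jointDistr μ), jointDistr_ofFn]

variable {μ}

lemma distr_apply_prod {A : Type*} [Ring A] [Algebra ℂ A] (φ : A →ₗ[ℂ] ℂ) (a : Fin m → A)
    (L : List (Fin m)) :
    distr φ a (L.map (FreeAlgebra.ι ℂ)).prod = φ (L.map a).prod := by
  rw [distr, LinearMap.comp_apply, AlgHom.toLinearMap_apply, map_list_prod, List.map_map]
  congr 3
  ext u
  simp

lemma distr_jointDistr (hμ : ∀ c, IsInfState (μ c)) (c : C) (i : Fin (k + 1)) :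
    distr (jointDistr μ i) (fun u => FreeAlgebra.ι ℂ (c, u)) = μ c i := by
  refine functional_ext fun L => ?_
  rw [distr_apply_prod]
  have h1 := jointDistr_ofFn μ (fun j => (c, L.get j)) i
  have h2 := ncSum_wordCumulant (hμ c) (FreeAlgebra.ι ℂ) L.get i
  have h3 : ncSum (jointCumulant μ) (fun j => (c, L.get j)) i =
      ncSum (wordCumulant (μ c) (FreeAlgebra.ι ℂ)) L.get i := by
    refine ncSum_congr (fun V hV i => ?_) i
    have h := mixCumulant_map (fun c => wordCumulant (μ c) (FreeAlgebra.ι ℂ)) i c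
      (subword_ne_nil (w := L.get) hV)
    rw [← h, jointCumulant]
    simp [subword, Function.comp_def]
  rw [h3, h2] at h1
  rw [ofFn_comp_get (fun u => FreeAlgebra.ι ℂ (c, u)), ofFn_comp_get (FreeAlgebra.ι ℂ)] at h1
  exact h1

lemma infinitesimallyFree_jointDistr :
    InfinitesimallyFree (jointDistr μ)
      fun c => Set.range fun u => (FreeAlgebra.ι ℂ (c, u) : FreeAlgebra ℂ (C × Fin m)) := by
  intro i n a c ha ⟨s, t, hst⟩
  choose u hu using ha
  obtain rfl : (fun j => FreeAlgebra.ι ℂ (c j, u j)) = a := funext hu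
  rw [← wordCumulant_ofFn (jointDistr μ) (FreeAlgebra.ι ℂ) i fun j => (c j, u j),
    wordCumulant_jointDistr]
  · exact mixCumulant_of_ne _ _ ⟨(c s, u s), (List.mem_ofFn' _ _).2 ⟨s, rfl⟩, (c t, u t),
      (List.mem_ofFn' _ _).2 ⟨t, rfl⟩, hst⟩
  · intro h
    have : n = 0 := by simpa using congrArg List.length h
    subst this
    exact s.elim0

/-- The joint infinitesimal distribution of infinitesimally free tuples. -/
theorem InfinitesimallyFree.joint_eq {A : Type*} [Ring A] [Algebra ℂ A]
    {φ : Fin (k + 1) → (A →ₗ[ℂ] ℂ)} (hφ : IsInfState φ) {x : C × Fin m → A}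
    (hf : InfinitesimallyFree φ fun c => Set.range fun u => x (c, u))
    (hd : ∀ c i, distr (φ i) (fun u => x (c, u)) = μ c i) (i : Fin (k + 1)) :
    φ i ∘ₗ (FreeAlgebra.lift ℂ x).toLinearMap = jointDistr μ i := by
  have hμ : ∀ c, IsInfState (μ c) := fun c i => by
    rw [← hd, distr]
    simpa using hφ i
  have hκ : ∀ (L : List (C × Fin m)), L ≠ [] → ∀ i,
      wordCumulant φ x i L = jointCumulant μ i L := by
    intro L hL i
    by_cases hmix : ∃ x ∈ L, ∃ y ∈ L, x.1 ≠ y.1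
    · rw [jointCumulant, mixCumulant_of_ne _ _ hmix]
      obtain ⟨y, hy, z, hz, hne⟩ := hmix
      obtain ⟨s, rfl⟩ := List.mem_iff_get.1 hy
      obtain ⟨t, rfl⟩ := List.mem_iff_get.1 hz
      exact hf i L.length _ (fun j => (L.get j).1) (fun j => ⟨(L.get j).2, rfl⟩) ⟨s, t, hne⟩
    · obtain ⟨y, L', rfl⟩ := List.exists_cons_of_ne_nil hL
      push Not at hmix
      have h1 : y :: L' = ((y :: L').map Prod.snd).map fun u => (y.1, u) := by
        rw [List.map_map]
        conv_lhs => rw [← List.map_id (y :: L')]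
        refine List.map_congr_left fun z hz => ?_
        rw [Function.comp_apply, hmix y (by simp) z hz]
        rfl
      generalize (y :: L').map Prod.snd = M at h1
      have hM : M ≠ [] := by
        rintro rfl
        simp at h1
      rw [h1, jointCumulant, mixCumulant_map _ _ _ hM]
      -- On a word of a single colour the cumulant depends only on the marginal of that colour.
      rw [← wordCumulant_eq hφ (hμ y.1) (x := fun u => x (y.1, u)) (fun W i => ?_) hM]
      · conv_lhs => rw [← List.ofFn_get M, List.map_ofFn, wordCumulant_ofFn]
        rfl
      · rw [← hd, distr_apply_prod]
  refine functional_ext fun L => ?_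
  rw [jointDistr_prod, LinearMap.comp_apply, AlgHom.toLinearMap_apply, map_list_prod,
    List.map_map]
  have h2 := ncSum_wordCumulant hφ x L.get i
  rw [ncSum_congr (κ' := jointCumulant μ) (w' := L.get)
    (fun V hV i => hκ _ (subword_ne_nil hV) i) i] at h2
  rw [h2]
  congr 2
  conv_lhs => rw [← List.ofFn_get L]
  rw [List.map_ofFn]
  congr 1
  ext j
  simp

variable {ν : C → (FreeAlgebra ℂ (Fin m) →ₗ[ℂ] ℂ)}

lemma isInfState_const {A : Type*} [Ring A] [Algebra ℂ A] {φ : A →ₗ[ℂ] ℂ} (h : φ 1 = 1) :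
    IsInfState (k := 0) fun _ => φ := fun i => by
  rw [if_pos (Fin.fin_one_eq_zero i), h]

/-- At order `k = 0` the infinitesimal formula is the plain sum over non-crossing partitions, which
is the moment formula of the Fock model. -/
lemma vacuum_comp_lift : vacuum ∘ₗ
    (FreeAlgebra.lift ℂ (fockOp (jointCumulant (k := 0) (fun c _ => ν c) 0))).toLinearMap =
      jointDistr (k := 0) (fun c _ => ν c) 0 := by
  refine functional_ext fun L => ?_
  rw [jointDistr_prod, LinearMap.comp_apply, AlgHom.toLinearMap_apply, map_list_prod,
    List.map_map]
  have h := vacuum_prod_fockOp (jointCumulant (k := 0) (fun c _ => ν c) 0) L.get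
  rw [ncSum, Finset.sum_congr rfl fun p _ => blockSum_zero _ _ p, ← h]
  congr 2
  conv_lhs => rw [← List.ofFn_get L]
  rw [List.map_ofFn]
  congr 1
  ext j
  simp

/-- Free tuples with given distributions exist, and have the joint distribution whose mixed
cumulants vanish. -/
lemma free_fockOp_jointCumulant :
    Free vacuum fun c => Set.range fun u : Fin m =>
      fockOp (jointCumulant (k := 0) (fun c _ => ν c) 0) (c, u) :=
  free_vacuum fun _ hL => mixCumulant_of_ne _ _ hL

lemma distr_vacuum (hν : ∀ c, ν c 1 = 1) (c : C) :
    distr vacuum (fun u => fockOp (jointCumulant (k := 0) (fun c _ => ν c) 0) (c, u)) = ν c := by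
  have h := distr_jointDistr (k := 0) (μ := fun c _ => ν c) (fun c => isInfState_const (hν c)) c 0
  rw [← vacuum_comp_lift] at h
  rw [← h]
  refine LinearMap.ext fun Q => ?_
  simp only [distr, LinearMap.comp_apply, AlgHom.toLinearMap_apply, lift_lift_colour]

/-- The joint distribution of free tuples. -/
theorem Free.joint_eq {A : Type*} [Ring A] [Algebra ℂ A]
    {φ : A →ₗ[ℂ] ℂ} (hφ : φ 1 = 1) {x : C × Fin m → A}
    (hf : Free φ fun c => Set.range fun u => x (c, u))
    (hd : ∀ c, distr φ (fun u => x (c, u)) = ν c) :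
    φ ∘ₗ (FreeAlgebra.lift ℂ x).toLinearMap = jointDistr (k := 0) (fun c _ => ν c) 0 := by
  have hν : ∀ c, ν c 1 = 1 := fun c => by
    rw [← hd, distr]
    simpa using hφ
  rw [← vacuum_comp_lift]
  refine hf.unique hφ (by simp [vacuum_apply]) free_fockOp_jointCumulant fun c => ?_
  rw [hd, distr_vacuum hν]

end Joint

/-! ### Taylor expansions along a filter -/

section Jets

open Asymptotics

variable {k : ℕ} {l : Filter ℝ} {f g : ℝ → ℂ} {p q : PowerSeries ℂ}

/-- `f` has along `l` the Taylor expansion `p` at `0`, up to order `k`. -/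
def HasJet (k : ℕ) (l : Filter ℝ) (f : ℝ → ℂ) (p : PowerSeries ℂ) : Prop :=
  (fun t : ℝ => f t - (p.trunc (k + 1)).eval (t : ℂ)) =o[l] fun t : ℝ => (t : ℂ) ^ k

lemma HasJet.congr (h : HasJet k l f p) (hpq : ∀ i ≤ k, p.coeff i = q.coeff i) :
    HasJet k l f q := by
  have : p.trunc (k + 1) = q.trunc (k + 1) := by
    ext i
    simp only [PowerSeries.coeff_trunc]
    split_ifs with hi
    · exact hpq i (Nat.lt_succ_iff.1 hi)
    · rfl
  rwa [HasJet, ← this]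

lemma HasJet.add (hf : HasJet k l f p) (hg : HasJet k l g q) :
    HasJet k l (fun t => f t + g t) (p + q) := by
  refine (IsLittleO.add hf hg).congr_left fun t => ?_
  rw [map_add, Polynomial.eval_add]
  ring

lemma hasJet_const (k : ℕ) (l : Filter ℝ) (c : ℂ) :
    HasJet k l (fun _ => c) (PowerSeries.C c) := by
  refine (isLittleO_zero _ l).congr_left fun t => ?_
  simp

lemma tendsto_eval (hl : l ≤ 𝓝 0) (P : Polynomial ℂ) :
    Tendsto (fun t : ℝ => P.eval (t : ℂ)) l (𝓝 (P.eval 0)) := by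
  have h : Continuous fun t : ℝ => P.eval (t : ℂ) :=
    P.continuous.comp Complex.continuous_ofReal
  have := h.tendsto 0
  rw [Complex.ofReal_zero] at this
  exact this.mono_left hl

lemma eval_isLittleO (hl : l ≤ 𝓝 0) {P : Polynomial ℂ} (hP : ∀ i ≤ k, P.coeff i = 0) :
    (fun t : ℝ => P.eval (t : ℂ)) =o[l] fun t : ℝ => (t : ℂ) ^ k := by
  obtain ⟨Q, rfl⟩ := Polynomial.X_pow_dvd_iff.2 fun i (hi : i < k + 1) =>
    hP i (Nat.lt_succ_iff.1 hi)
  have h : (fun t : ℝ => (Polynomial.X * Q).eval (t : ℂ)) =o[l] fun _ => (1 : ℂ) := by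
    rw [isLittleO_one_iff]
    have := tendsto_eval hl (Polynomial.X * Q)
    rwa [Polynomial.eval_mul, Polynomial.eval_X, zero_mul] at this
  refine ((isBigO_refl (fun t : ℝ => (t : ℂ) ^ k) l).mul_isLittleO h).congr (fun t => ?_)
    fun t => ?_
  · simp only [Polynomial.eval_mul, Polynomial.eval_X, Polynomial.eval_pow]
    ring
  · simp

lemma HasJet.mono (hl : l ≤ 𝓝 0) (h : HasJet k l f p) {i : ℕ} (hi : i ≤ k) :
    HasJet i l f p := by
  have h1 : (fun t : ℝ => (t : ℂ) ^ k) =O[l] fun t : ℝ => (t : ℂ) ^ i := by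
    have h2 : (fun t : ℝ => (t : ℂ) ^ (k - i)) =O[l] fun _ => (1 : ℂ) := by
      have := tendsto_eval hl (Polynomial.X ^ (k - i))
      simp only [Polynomial.eval_pow, Polynomial.eval_X] at this
      exact this.isBigO_one ℂ
    refine ((isBigO_refl (fun t : ℝ => (t : ℂ) ^ i) l).mul h2).congr (fun t => ?_) fun t => ?_
    · rw [← pow_add, Nat.add_sub_cancel' hi]
    · simp
  have h3 : (fun t : ℝ => (p.trunc (k + 1) - p.trunc (i + 1)).eval (t : ℂ)) =o[l]
      fun t : ℝ => (t : ℂ) ^ i := by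
    refine eval_isLittleO hl fun j hj => ?_
    rw [Polynomial.coeff_sub, PowerSeries.coeff_trunc, PowerSeries.coeff_trunc,
      if_pos (by omega), if_pos (by omega), sub_self]
  refine ((IsLittleO.trans_isBigO h h1).add h3).congr_left fun t => ?_
  rw [Polynomial.eval_sub]
  ring

/-- With Taylor polynomials `P`, `Q`, write `f g - P Q = (f - P) g + P (g - Q)`, where `g` and `P`
are bounded. Truncating `P Q` costs only powers above `k`. -/
lemma HasJet.mul (hl : l ≤ 𝓝 0) (hf : HasJet k l f p) (hg : HasJet k l g q) :
    HasJet k l (fun t => f t * g t) (p * q) := by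
  have hb : ∀ P : Polynomial ℂ, (fun t : ℝ => P.eval (t : ℂ)) =O[l] fun _ => (1 : ℂ) :=
    fun P => (tendsto_eval hl P).isBigO_one ℂ
  have hgb : g =O[l] fun _ => (1 : ℂ) := by
    have h1 : (fun t : ℝ => (t : ℂ) ^ k) =O[l] fun _ => (1 : ℂ) := by
      simpa using hb (Polynomial.X ^ k)
    refine ((IsLittleO.isBigO hg).trans h1 |>.add (hb (q.trunc (k + 1)))).congr_left fun t => ?_
    ring
  have h1 := (IsLittleO.mul_isBigO hf hgb)
  have h2 := (hb (p.trunc (k + 1))).mul_isLittleO hg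
  have h3 : (fun t : ℝ => (p.trunc (k + 1) * q.trunc (k + 1) -
      (p * q).trunc (k + 1)).eval (t : ℂ)) =o[l] fun t : ℝ => (t : ℂ) ^ k := by
    refine eval_isLittleO hl fun i hi => ?_
    rw [Polynomial.coeff_sub, PowerSeries.coeff_trunc, if_pos (by omega), Polynomial.coeff_mul,
      PowerSeries.coeff_mul, sub_eq_zero]
    refine Finset.sum_congr rfl fun ij hij => ?_
    have := Finset.HasAntidiagonal.mem_antidiagonal.1 hij
    rw [PowerSeries.coeff_trunc, PowerSeries.coeff_trunc, if_pos (by omega), if_pos (by omega)]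
  simp only [mul_one, one_mul] at h1 h2
  refine ((h1.add h2).add h3).congr_left fun t => ?_
  simp only [Polynomial.eval_sub, Polynomial.eval_mul]
  ring

lemma HasJet.sum {β : Type*} (s : Finset β) {f : β → ℝ → ℂ} {p : β → PowerSeries ℂ}
    (h : ∀ b ∈ s, HasJet k l (f b) (p b)) :
    HasJet k l (fun t => ∑ b ∈ s, f b t) (∑ b ∈ s, p b) := by
  classical
  induction s using Finset.induction_on with
  | empty => simpa using hasJet_const k l 0
  | insert b s hb ih =>
    simp only [Finset.sum_insert hb]
    exact (h b (Finset.mem_insert_self _ _)).add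
      (ih fun b' hb' => h b' (Finset.mem_insert_of_mem hb'))

lemma HasJet.prod (hl : l ≤ 𝓝 0) {β : Type*} (s : Finset β) {f : β → ℝ → ℂ}
    {p : β → PowerSeries ℂ} (h : ∀ b ∈ s, HasJet k l (f b) (p b)) :
    HasJet k l (fun t => ∏ b ∈ s, f b t) (∏ b ∈ s, p b) := by
  classical
  induction s using Finset.induction_on with
  | empty => simpa using hasJet_const k l 1
  | insert b s hb ih =>
    simp only [Finset.prod_insert hb]
    exact (h b (Finset.mem_insert_self _ _)).mul hl
      (ih fun b' hb' => h b' (Finset.mem_insert_of_mem hb'))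

lemma hasJet_iff_tendsto (hl : ∀ᶠ t in l, t ≠ 0) :
    HasJet k l f p ↔ Tendsto (fun t : ℝ => (1 / (t : ℂ) ^ k) *
      (f t - ∑ j ∈ Finset.range k, (t : ℂ) ^ j * p.coeff j)) l (𝓝 (p.coeff k)) := by
  rw [HasJet, isLittleO_iff_tendsto', ← tendsto_sub_nhds_zero_iff (x := p.coeff k)]
  · refine tendsto_congr' ?_
    filter_upwards [hl] with t ht
    have ht' : (t : ℂ) ^ k ≠ 0 := pow_ne_zero _ (by exact_mod_cast ht)
    rw [Polynomial.eval, PowerSeries.eval₂_trunc_eq_sum_range, Finset.sum_range_succ]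
    simp only [RingHom.id_apply, mul_comm (p.coeff _)]
    field_simp
    ring_nf
  · filter_upwards [hl] with t ht h
    exact absurd h (pow_ne_zero _ (by exact_mod_cast ht))

/-- The Taylor polynomial with given derivatives at `0`. -/
noncomputable def jetSeries (d : Fin (k + 1) → ℂ) : PowerSeries ℂ :=
  PowerSeries.mk fun i => if h : i < k + 1 then d ⟨i, h⟩ / (Nat.factorial i : ℂ) else 0

lemma coeff_jetSeries (d : Fin (k + 1) → ℂ) (i : Fin (k + 1)) :
    (jetSeries d).coeff i = d i / (Nat.factorial i : ℂ) := by
  rw [jetSeries, PowerSeries.coeff_mk, dif_pos i.2]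

lemma HasJet.jet_congr {d : Fin (k + 1) → ℂ} (h : HasJet k l f p)
    (hp : ∀ i : Fin (k + 1), p.coeff i = d i / (Nat.factorial i : ℂ)) :
    HasJet k l f (jetSeries d) :=
  h.congr fun i hi => by
    rw [hp ⟨i, Nat.lt_succ_of_le hi⟩, coeff_jetSeries d ⟨i, Nat.lt_succ_of_le hi⟩]

/-- The Leibniz rule: for `l` of sum `i`, the quotient of `multi l` by `i!` is the product of the `1
/ (l b)!`. -/
lemma coeff_prod_jetSeries {β : Type*} [Fintype β] [DecidableEq β] (d : β → Fin (k + 1) → ℂ)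
    (i : Fin (k + 1)) :
    (∏ b, jetSeries (d b)).coeff i =
      (∑ l ∈ Lam i, multi l * ∏ b, d b (l b)) / (Nat.factorial i : ℂ) := by
  rw [PowerSeries.coeff_prod, Finset.sum_div]
  symm
  refine Finset.sum_bij (fun l _ => Finsupp.equivFunOnFinite.symm fun b => (l b : ℕ)) ?_ ?_ ?_ ?_
  · intro l hl
    rw [Finset.mem_finsuppAntidiag]
    simpa [Lam] using hl
  · intro l _ l' _ h
    have := Finsupp.equivFunOnFinite.symm.injective h
    exact funext fun b => Fin.ext (congrFun this b)
  · intro l hl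
    rw [Finset.mem_finsuppAntidiag] at hl
    have hle : ∀ b, l b < k + 1 := fun b =>
      (Finset.single_le_sum (f := fun b => l b) (fun _ _ => Nat.zero_le _)
        (Finset.mem_univ b)).trans_lt (hl.1 ▸ i.2)
    refine ⟨fun b => ⟨l b, hle b⟩, ?_, ?_⟩
    · simpa [Lam] using hl.1
    · ext b
      simp
  · intro l hl
    have hsum : ∑ b, (l b : ℕ) = i := by simpa [Lam] using hl
    have hspec := Nat.multinomial_spec Finset.univ fun b => (l b : ℕ)
    rw [hsum] at hspec
    have hspec' : (∏ b, ((l b : ℕ).factorial : ℂ)) * multi l = ((i : ℕ).factorial : ℂ) := by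
      rw [multi]
      exact_mod_cast hspec
    have h0 : (∏ b, ((l b : ℕ).factorial : ℂ)) ≠ 0 :=
      Finset.prod_ne_zero_iff.2 fun b _ => by exact_mod_cast Nat.factorial_ne_zero _
    have hm : multi l ≠ 0 := by
      intro h
      rw [h, mul_zero] at hspec'
      exact absurd hspec'.symm (by exact_mod_cast Nat.factorial_ne_zero _)
    simp only [Finsupp.equivFunOnFinite_symm_apply_apply, coeff_jetSeries, Finset.prod_div_distrib]
    rw [← hspec']
    field_simp

end Jets

/-! ### Expansions of cumulants and of joint distributions -/

section JetsOfDistributions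

variable {k m : ℕ} {l : Filter ℝ}

lemma HasJet.congr_fun {f g : ℝ → ℂ} {p : PowerSeries ℂ} (h : HasJet k l f p) (hfg : f =ᶠ[l] g) :
    HasJet k l g p := by
  refine Asymptotics.IsLittleO.congr' h ?_ EventuallyEq.rfl
  filter_upwards [hfg] with t ht
  rw [ht]

/-- Once the lower coefficients agree, the `i`-th ones are limits of the same function. -/
lemma HasJet.unique [l.NeBot] (hl : l ≤ 𝓝 0) (hl0 : ∀ᶠ t in l, t ≠ 0) {f : ℝ → ℂ}
    {p q : PowerSeries ℂ} (hp : HasJet k l f p) (hq : HasJet k l f q) :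
    ∀ i ≤ k, p.coeff i = q.coeff i := by
  intro i
  induction i using Nat.strong_induction_on with
  | _ i ih =>
    intro hi
    have h1 := (hasJet_iff_tendsto hl0).1 (hp.mono hl hi)
    have h2 := (hasJet_iff_tendsto hl0).1 (hq.mono hl hi)
    refine tendsto_nhds_unique (h1.congr fun t => ?_) h2
    congr 2
    refine Finset.sum_congr rfl fun j hj => ?_
    rw [ih j (Finset.mem_range.1 hj) ((Finset.mem_range.1 hj).le.trans hi)]

lemma HasJet.jet_add {f g : ℝ → ℂ} {d e : Fin (k + 1) → ℂ}
    (hf : HasJet k l f (jetSeries d)) (hg : HasJet k l g (jetSeries e)) :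
    HasJet k l (fun t => f t + g t) (jetSeries fun i => d i + e i) :=
  (hf.add hg).jet_congr fun i => by
    rw [map_add, coeff_jetSeries, coeff_jetSeries, add_div]

lemma HasJet.jet_smul (hl : l ≤ 𝓝 0) {f : ℝ → ℂ} {d : Fin (k + 1) → ℂ}
    (c : ℂ) (hf : HasJet k l f (jetSeries d)) :
    HasJet k l (fun t => c * f t) (jetSeries fun i => c * d i) :=
  ((hasJet_const k l c).mul hl hf).jet_congr fun i => by
    rw [PowerSeries.coeff_C_mul, coeff_jetSeries, mul_div_assoc]

lemma HasJet.jet_sum {β : Type*} (s : Finset β) {f : β → ℝ → ℂ} {d : β → Fin (k + 1) → ℂ}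
    (h : ∀ b ∈ s, HasJet k l (f b) (jetSeries (d b))) :
    HasJet k l (fun t => ∑ b ∈ s, f b t) (jetSeries fun i => ∑ b ∈ s, d b i) :=
  (HasJet.sum s h).jet_congr fun i => by
    rw [map_sum, Finset.sum_div]
    exact Finset.sum_congr rfl fun b _ => coeff_jetSeries _ _

lemma hasJet_blockSum (hl : l ≤ 𝓝 0) {J : Type*} {n : ℕ} {w : Fin n → J}
    {κ : ℝ → Fin 1 → List J → ℂ} {κ' : Fin (k + 1) → List J → ℂ}
    {p : Finpartition (Finset.univ : Finset (Fin n))}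
    (h : ∀ V ∈ p.parts,
      HasJet k l (fun t => κ t 0 (subword w V)) (jetSeries fun i => κ' i (subword w V))) :
    HasJet k l (fun t => blockSum (k := 0) (κ t) w 0 p)
      (jetSeries fun i => blockSum κ' w i p) := by
  have h1 := HasJet.prod hl (Finset.univ : Finset p.parts) fun V _ => h V.1 V.2
  refine (h1.jet_congr fun i => coeff_prod_jetSeries _ i).congr_fun (.of_forall fun t => ?_)
  simp only [blockSum_zero, ← Finset.prod_coe_sort p.parts]

lemma hasJet_ncSum (hl : l ≤ 𝓝 0) {J : Type*} {n : ℕ} {w : Fin n → J}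
    {κ : ℝ → Fin 1 → List J → ℂ} {κ' : Fin (k + 1) → List J → ℂ}
    (h : ∀ L ≠ [], HasJet k l (fun t => κ t 0 L) (jetSeries fun i => κ' i L)) :
    HasJet k l (fun t => ncSum (k := 0) (κ t) w 0) (jetSeries fun i => ncSum κ' w i) :=
  HasJet.jet_sum _ fun p _ => hasJet_blockSum hl fun _ hV =>
    h _ (subword_ne_nil (p.nonempty_of_mem_parts hV))

/-- A cumulant is a moment minus products of cumulants of shorter words. The recursion has the same
shape at order `0` (for `μ t`) and at order `k` (for `μ'`), and `hasJet_blockSum` differentiates the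
products. -/
lemma hasJet_wordCumulant (hl : l ≤ 𝓝 0) {μ : ℝ → (FreeAlgebra ℂ (Fin m) →ₗ[ℂ] ℂ)}
    {μ' : Fin (k + 1) → (FreeAlgebra ℂ (Fin m) →ₗ[ℂ] ℂ)}
    (h : ∀ P, HasJet k l (fun t => μ t P) (jetSeries fun i => μ' i P))
    (L : List (Fin m)) (hL : L ≠ []) :
    HasJet k l (fun t => wordCumulant (k := 0) (fun _ => μ t) (FreeAlgebra.ι ℂ) 0 L)
      (jetSeries fun i => wordCumulant μ' (FreeAlgebra.ι ℂ) i L) := by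
  induction hN : L.length using Nat.strong_induction_on generalizing L with
  | _ N ih =>
    have hN0 : L.length ≠ 0 := fun h0 => hL (List.length_eq_zero_iff.1 h0)
    have key : ∀ {k : ℕ} (φ : Fin (k + 1) → (FreeAlgebra ℂ (Fin m) →ₗ[ℂ] ℂ)) (i : Fin (k + 1)),
        wordCumulant φ (FreeAlgebra.ι ℂ) i L = φ i (L.map (FreeAlgebra.ι ℂ)).prod + (-1) *
          ∑ p ∈ (NC L.length).filter (fun p => Finset.univ ∉ p.parts),
            blockSum (wordCumulant φ (FreeAlgebra.ι ℂ)) L.get i p := by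
      intro k φ i
      have h1 := ncSum_wordCumulant_of_ne_zero φ (FreeAlgebra.ι ℂ) hN0 L.get i
      rw [ncSum_eq_add _ _ hN0, List.ofFn_get, ofFn_comp_get (FreeAlgebra.ι ℂ)] at h1
      rw [← h1]
      ring
    simp only [key]
    refine (h _).jet_add (HasJet.jet_smul hl _ (HasJet.jet_sum _ fun p hp =>
      hasJet_blockSum (κ := fun t => wordCumulant (k := 0) (fun _ => μ t) (FreeAlgebra.ι ℂ))
        hl fun V hV => ih _ ?_ _ (subword_ne_nil (p.nonempty_of_mem_parts hV)) rfl))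
    rw [length_subword, ← hN]
    refine card_lt_of_ne_univ V ?_
    rintro rfl
    exact (Finset.mem_filter.1 hp).2 hV

lemma hasJet_jointDistr (hl : l ≤ 𝓝 0) {C : Type*} [Fintype C] [DecidableEq C]
    {μ : C → ℝ → (FreeAlgebra ℂ (Fin m) →ₗ[ℂ] ℂ)}
    {μ' : C → Fin (k + 1) → (FreeAlgebra ℂ (Fin m) →ₗ[ℂ] ℂ)}
    (h : ∀ c P, HasJet k l (fun t => μ c t P) (jetSeries fun i => μ' c i P))
    (P : FreeAlgebra ℂ (C × Fin m)) :
    HasJet k l (fun t => jointDistr (k := 0) (fun c _ => μ c t) 0 P)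
      (jetSeries fun i => jointDistr μ' i P) := by
  have h0 : HasJet k l (fun _ => 0) (jetSeries fun _ : Fin (k + 1) => 0) :=
    (hasJet_const k l 0).jet_congr fun i => by simp
  have hκ : ∀ L : List (C × Fin m), L ≠ [] →
      HasJet k l (fun t => jointCumulant (k := 0) (fun c _ => μ c t) 0 L)
        (jetSeries fun i => jointCumulant μ' i L) := by
    intro L hL
    refine HasJet.jet_sum _ fun c _ => ?_
    split_ifs
    · exact hasJet_wordCumulant hl (h c) _ (by simpa using hL)
    · exact h0
  have hP : P ∈ Submodule.span ℂ (Set.range (FreeAlgebra.basisFreeMonoid ℂ (C × Fin m))) := by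
    rw [Module.Basis.span_eq]
    trivial
  induction hP using Submodule.span_induction with
  | mem P hP =>
    obtain ⟨L, rfl⟩ := hP
    rw [basisFreeMonoid_apply]
    simp only [jointDistr_prod]
    exact hasJet_ncSum hl hκ
  | zero => simpa using h0
  | add P Q _ _ hP hQ =>
    simp only [map_add]
    exact hP.jet_add hQ
  | smul c P _ hP =>
    simp only [map_smul, smul_eq_mul]
    exact hP.jet_smul hl c

/-- The limit of order `i` is an expansion with error `o(t^i)`; the one for `i = k` implies the
others. -/
lemma hasDerivsAtZero_iff {K : Set ℝ} {μ : ℝ → (FreeAlgebra ℂ (Fin m) →ₗ[ℂ] ℂ)}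
    {d : Fin (k + 1) → (FreeAlgebra ℂ (Fin m) →ₗ[ℂ] ℂ)} :
    HasDerivsAtZero K μ d ↔
      ∀ P, HasJet k (𝓝[K \ {0}] 0) (fun t => μ t P) (jetSeries fun i => d i P) := by
  have hl0 : ∀ᶠ t in 𝓝[K \ {0}] (0 : ℝ), t ≠ 0 := by
    filter_upwards [self_mem_nhdsWithin] with t ht using ht.2
  have key : ∀ (i : Fin (k + 1)) (P : FreeAlgebra ℂ (Fin m)) (t : ℝ),
      ∑ j ∈ Finset.Iio i, ((t : ℂ) ^ (j : ℕ) / (Nat.factorial (j : ℕ) : ℂ)) * d j P =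
        ∑ j ∈ Finset.range i, (t : ℂ) ^ j * (jetSeries fun i => d i P).coeff j := by
    intro i P t
    rw [← Nat.Iio_eq_range, ← Fin.map_valEmbedding_Iio, Finset.sum_map]
    refine Finset.sum_congr rfl fun j _ => ?_
    rw [Fin.valEmbedding_apply, coeff_jetSeries]
    ring
  have key2 : ∀ (i : Fin (k + 1)) (P : FreeAlgebra ℂ (Fin m)),
      Tendsto
        (fun t : ℝ => (1 / (t : ℂ) ^ (i : ℕ)) *
          (μ t P - ∑ j ∈ Finset.Iio i, ((t : ℂ) ^ (j : ℕ) / (Nat.factorial (j : ℕ) : ℂ)) * d j P))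
        (𝓝[K \ {0}] 0) (𝓝 (d i P / (Nat.factorial (i : ℕ) : ℂ))) ↔
      HasJet i (𝓝[K \ {0}] 0) (fun t => μ t P) (jetSeries fun i => d i P) := by
    intro i P
    rw [hasJet_iff_tendsto hl0, coeff_jetSeries (fun i => d i P) i]
    simp only [key]
  constructor
  · intro h P
    simpa using (key2 (Fin.last k) P).1 (h (Fin.last k) P)
  · intro h i P
    exact (key2 i P).2 ((h P).mono nhdsWithin_le_nhds (Nat.lt_succ_iff.1 i.2))

/-- At `1` the family is constant on `K`, so uniqueness of expansions applies. Since `0` is an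
accumulation point of `K`, the filter is nontrivial. -/
lemma HasDerivsAtZero.isInfState {K : Set ℝ} (hK : AccPt (0 : ℝ) (𝓟 K))
    {μ : ℝ → (FreeAlgebra ℂ (Fin m) →ₗ[ℂ] ℂ)} (hμ : ∀ t ∈ K, μ t 1 = 1)
    {d : Fin (k + 1) → (FreeAlgebra ℂ (Fin m) →ₗ[ℂ] ℂ)} (h : HasDerivsAtZero K μ d) :
    IsInfState d := by
  have hne : (𝓝[K \ {0}] (0 : ℝ)).NeBot := by
    rw [accPt_principal_iff_nhdsWithin] at hK
    exact hK
  have hl0 : ∀ᶠ t in 𝓝[K \ {0}] (0 : ℝ), t ≠ 0 := by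
    filter_upwards [self_mem_nhdsWithin] with t ht using ht.2
  intro i
  have h1 : HasJet k (𝓝[K \ {0}] 0) (fun t => μ t 1) (PowerSeries.C 1) := by
    refine (hasJet_const k _ 1).congr_fun ?_
    filter_upwards [self_mem_nhdsWithin] with t ht using (hμ t ht.1).symm
  have h2 := (hasDerivsAtZero_iff.1 h 1).unique nhdsWithin_le_nhds hl0 h1 i
    (Nat.lt_succ_iff.1 i.2)
  rw [coeff_jetSeries (fun i => d i 1) i, PowerSeries.coeff_C,
    div_eq_iff (by exact_mod_cast Nat.factorial_ne_zero _)] at h2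
  rw [h2]
  by_cases hi : i = 0
  · simp [hi]
  · have : (i : ℕ) ≠ 0 := fun h => hi (Fin.ext h)
    simp [hi, this]

end JetsOfDistributions

/-! ### The four convolutions as explicit functionals -/

section Convolutions

variable {k m : ℕ}

lemma pair_eq_range {A : Type*} (a b : Fin m → A) :
    (![Set.range a, Set.range b] : Fin 2 → Set A) =
      fun c => Set.range fun u => (fun x : Fin 2 × Fin m => ![a, b] x.1 x.2) (c, u) := by
  funext c
  fin_cases c <;> rfl

lemma distr_lift {J A : Type*} [Ring A] [Algebra ℂ A] (φ : A →ₗ[ℂ] ℂ) (x : J → A)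
    (q : Fin m → FreeAlgebra ℂ J) :
    distr φ (fun u => FreeAlgebra.lift ℂ x (q u)) =
      distr (φ ∘ₗ (FreeAlgebra.lift ℂ x).toLinearMap) q := by
  have h : FreeAlgebra.lift ℂ (fun u => FreeAlgebra.lift ℂ x (q u)) =
      (FreeAlgebra.lift ℂ x).comp (FreeAlgebra.lift ℂ q) := by
    ext u
    simp
  rw [distr, h]
  rfl

/-- The joint distribution of free pairs of tuples. -/
noncomputable abbrev pairDistr (μ ν : FreeAlgebra ℂ (Fin m) →ₗ[ℂ] ℂ) :
    FreeAlgebra ℂ (Fin 2 × Fin m) →ₗ[ℂ] ℂ :=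
  jointDistr (k := 0) (fun c _ => ![μ, ν] c) 0

variable {μ ν σ : FreeAlgebra ℂ (Fin m) →ₗ[ℂ] ℂ}
  {μ' ν' η : Fin (k + 1) → (FreeAlgebra ℂ (Fin m) →ₗ[ℂ] ℂ)}

lemma Free.distr_pair {A : Type*} [Ring A] [Algebra ℂ A] {φ : A →ₗ[ℂ] ℂ} {a b : Fin m → A}
    (hφ : φ 1 = 1) (hf : Free φ ![Set.range a, Set.range b]) (ha : distr φ a = μ)
    (hb : distr φ b = ν) (q : Fin m → FreeAlgebra ℂ (Fin 2 × Fin m)) :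
    distr φ (fun u => FreeAlgebra.lift ℂ (fun x : Fin 2 × Fin m => ![a, b] x.1 x.2) (q u)) =
      distr (pairDistr μ ν) q := by
  rw [pair_eq_range] at hf
  have hd : ∀ c, distr φ (fun u => (fun x : Fin 2 × Fin m => ![a, b] x.1 x.2) (c, u)) =
      ![μ, ν] c := Fin.forall_fin_two.2 ⟨ha, hb⟩
  rw [distr_lift, pairDistr, ←
    Free.joint_eq (x := fun x : Fin 2 × Fin m => ![a, b] x.1 x.2) hφ hf hd]

lemma exists_free_pair (hμ : μ 1 = 1) (hν : ν 1 = 1) :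
    ∃ (A : Type) (_ : Ring A) (_ : Algebra ℂ A) (φ : A →ₗ[ℂ] ℂ) (a b : Fin m → A),
      φ 1 = 1 ∧ Free φ ![Set.range a, Set.range b] ∧ distr φ a = μ ∧ distr φ b = ν := by
  have h1 : ∀ c, ![μ, ν] c 1 = 1 := by
    intro c
    fin_cases c
    · exact hμ
    · exact hν
  let X := fockOp (jointCumulant (k := 0) (fun c _ => ![μ, ν] c) 0)
  refine ⟨_, inferInstance, inferInstance, vacuum, fun u => X (0, u), fun u => X (1, u),
    by simp [vacuum_apply], ?_, distr_vacuum h1 0, distr_vacuum h1 1⟩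
  convert free_fockOp_jointCumulant (ν := ![μ, ν]) using 1
  funext c
  fin_cases c <;> rfl

lemma isFreeAddConv_iff (hμ : μ 1 = 1) (hν : ν 1 = 1) :
    IsFreeAddConv μ ν σ ↔ σ = distr (pairDistr μ ν)
      fun u => FreeAlgebra.ι ℂ (0, u) + FreeAlgebra.ι ℂ (1, u) := by
  have key : ∀ {A : Type} [Ring A] [Algebra ℂ A] {φ : A →ₗ[ℂ] ℂ} {a b : Fin m → A}, φ 1 = 1 →
      Free φ ![Set.range a, Set.range b] → distr φ a = μ → distr φ b = ν →
      distr φ (fun u => a u + b u) = distr (pairDistr μ ν)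
        fun u => FreeAlgebra.ι ℂ (0, u) + FreeAlgebra.ι ℂ (1, u) := by
    intro A _ _ φ a b hφ hf ha hb
    rw [← hf.distr_pair hφ ha hb]
    simp
  constructor
  · rintro ⟨A, _, _, φ, a, b, hφ, hf, ha, hb, rfl⟩
    exact key hφ hf ha hb
  · rintro rfl
    obtain ⟨A, _, _, φ, a, b, hφ, hf, ha, hb⟩ := exists_free_pair hμ hν
    exact ⟨A, _, _, φ, a, b, hφ, hf, ha, hb, key hφ hf ha hb⟩

lemma isFreeMulConv_iff (hμ : μ 1 = 1) (hν : ν 1 = 1) :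
    IsFreeMulConv μ ν σ ↔ σ = distr (pairDistr μ ν)
      fun u => FreeAlgebra.ι ℂ (0, u) * FreeAlgebra.ι ℂ (1, u) := by
  have key : ∀ {A : Type} [Ring A] [Algebra ℂ A] {φ : A →ₗ[ℂ] ℂ} {a b : Fin m → A}, φ 1 = 1 →
      Free φ ![Set.range a, Set.range b] → distr φ a = μ → distr φ b = ν →
      distr φ (fun u => a u * b u) = distr (pairDistr μ ν)
        fun u => FreeAlgebra.ι ℂ (0, u) * FreeAlgebra.ι ℂ (1, u) := by
    intro A _ _ φ a b hφ hf ha hb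
    rw [← hf.distr_pair hφ ha hb]
    simp
  constructor
  · rintro ⟨A, _, _, φ, a, b, hφ, hf, ha, hb, rfl⟩
    exact key hφ hf ha hb
  · rintro rfl
    obtain ⟨A, _, _, φ, a, b, hφ, hf, ha, hb⟩ := exists_free_pair hμ hν
    exact ⟨A, _, _, φ, a, b, hφ, hf, ha, hb, key hφ hf ha hb⟩

lemma InfinitesimallyFree.distr_pair {A : Type*} [Ring A] [Algebra ℂ A]
    {φ : Fin (k + 1) → (A →ₗ[ℂ] ℂ)} {a b : Fin m → A}
    (hφ : IsInfState φ) (hf : InfinitesimallyFree φ ![Set.range a, Set.range b])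
    (ha : ∀ i, distr (φ i) a = μ' i) (hb : ∀ i, distr (φ i) b = ν' i)
    (q : Fin m → FreeAlgebra ℂ (Fin 2 × Fin m)) (i : Fin (k + 1)) :
    distr (φ i) (fun u => FreeAlgebra.lift ℂ (fun x : Fin 2 × Fin m => ![a, b] x.1 x.2) (q u)) =
      distr (jointDistr ![μ', ν'] i) q := by
  rw [pair_eq_range] at hf
  have hd : ∀ c i, distr (φ i) (fun u => (fun x : Fin 2 × Fin m => ![a, b] x.1 x.2) (c, u)) =
      ![μ', ν'] c i := Fin.forall_fin_two.2 ⟨ha, hb⟩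
  rw [distr_lift, hf.joint_eq hφ hd]

lemma exists_infinitesimallyFree_pair (hμ : IsInfState μ') (hν : IsInfState ν') :
    ∃ (A : Type) (_ : Ring A) (_ : Algebra ℂ A) (φ : Fin (k + 1) → (A →ₗ[ℂ] ℂ))
      (a b : Fin m → A), IsInfState φ ∧ InfinitesimallyFree φ ![Set.range a, Set.range b] ∧
      (∀ i, distr (φ i) a = μ' i) ∧ (∀ i, distr (φ i) b = ν' i) := by
  have h1 : ∀ c, IsInfState (![μ', ν'] c) := by
    intro c
    fin_cases c
    · exact hμ
    · exact hν
  refine ⟨_, inferInstance, inferInstance, jointDistr ![μ', ν'],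
    fun u => FreeAlgebra.ι ℂ (0, u), fun u => FreeAlgebra.ι ℂ (1, u),
    isInfState_jointDistr _, ?_, distr_jointDistr h1 0, distr_jointDistr h1 1⟩
  convert infinitesimallyFree_jointDistr (μ := ![μ', ν']) using 1
  funext c
  fin_cases c <;> rfl

lemma isInfFreeAddConv_iff (hμ : IsInfState μ') (hν : IsInfState ν') :
    IsInfFreeAddConv μ' ν' η ↔ η = fun i => distr (jointDistr ![μ', ν'] i)
      fun u => FreeAlgebra.ι ℂ (0, u) + FreeAlgebra.ι ℂ (1, u) := by
  have key : ∀ {A : Type} [Ring A] [Algebra ℂ A] {φ : Fin (k + 1) → (A →ₗ[ℂ] ℂ)}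
      {a b : Fin m → A}, IsInfState φ → InfinitesimallyFree φ ![Set.range a, Set.range b] →
      (∀ i, distr (φ i) a = μ' i) → (∀ i, distr (φ i) b = ν' i) →
      ∀ i, distr (φ i) (fun u => a u + b u) = distr (jointDistr ![μ', ν'] i)
        fun u => FreeAlgebra.ι ℂ (0, u) + FreeAlgebra.ι ℂ (1, u) := by
    intro A _ _ φ a b hφ hf ha hb i
    rw [← hf.distr_pair hφ ha hb]
    simp
  constructor
  · rintro ⟨A, _, _, φ, a, b, hφ, hf, ha, hb, hη⟩
    funext i
    rw [← hη, key hφ hf ha hb]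
  · rintro rfl
    obtain ⟨A, _, _, φ, a, b, hφ, hf, ha, hb⟩ := exists_infinitesimallyFree_pair hμ hν
    exact ⟨A, _, _, φ, a, b, hφ, hf, ha, hb, key hφ hf ha hb⟩

lemma isInfFreeMulConv_iff (hμ : IsInfState μ') (hν : IsInfState ν') :
    IsInfFreeMulConv μ' ν' η ↔ η = fun i => distr (jointDistr ![μ', ν'] i)
      fun u => FreeAlgebra.ι ℂ (0, u) * FreeAlgebra.ι ℂ (1, u) := by
  have key : ∀ {A : Type} [Ring A] [Algebra ℂ A] {φ : Fin (k + 1) → (A →ₗ[ℂ] ℂ)}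
      {a b : Fin m → A}, IsInfState φ → InfinitesimallyFree φ ![Set.range a, Set.range b] →
      (∀ i, distr (φ i) a = μ' i) → (∀ i, distr (φ i) b = ν' i) →
      ∀ i, distr (φ i) (fun u => a u * b u) = distr (jointDistr ![μ', ν'] i)
        fun u => FreeAlgebra.ι ℂ (0, u) * FreeAlgebra.ι ℂ (1, u) := by
    intro A _ _ φ a b hφ hf ha hb i
    rw [← hf.distr_pair hφ ha hb]
    simp
  constructor
  · rintro ⟨A, _, _, φ, a, b, hφ, hf, ha, hb, hη⟩
    funext i
    rw [← hη, key hφ hf ha hb]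
  · rintro rfl
    obtain ⟨A, _, _, φ, a, b, hφ, hf, ha, hb⟩ := exists_infinitesimallyFree_pair hμ hν
    exact ⟨A, _, _, φ, a, b, hφ, hf, ha, hb, key hφ hf ha hb⟩

/-- Differentiability at `0` of a noncommutative polynomial in free tuples. -/
lemma hasDerivsAtZero_distr_pairDistr {K : Set ℝ}
    {μ ν σ : ℝ → (FreeAlgebra ℂ (Fin m) →ₗ[ℂ] ℂ)}
    (hμ : HasDerivsAtZero K μ μ') (hν : HasDerivsAtZero K ν ν')
    (q : Fin m → FreeAlgebra ℂ (Fin 2 × Fin m))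
    (hσ : ∀ t ∈ K, σ t = distr (pairDistr (μ t) (ν t)) q) :
    HasDerivsAtZero K σ fun i => distr (jointDistr ![μ', ν'] i) q := by
  rw [hasDerivsAtZero_iff] at hμ hν ⊢
  intro P
  have h := hasJet_jointDistr (l := 𝓝[K \ {0}] 0) nhdsWithin_le_nhds (C := Fin 2)
    (μ := ![μ, ν]) (μ' := ![μ', ν']) (fun c P => by
      fin_cases c
      · exact hμ P
      -- A moment of the combined tuple is a joint moment, at `P` with `q` substituted for its
      -- variables.
      · exact hν P) (FreeAlgebra.lift ℂ q P)
  refine h.congr_fun ?_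
  filter_upwards [self_mem_nhdsWithin] with t ht
  rw [hσ t ht.1, pairDistr, distr, LinearMap.comp_apply, AlgHom.toLinearMap_apply]
  congr 2
  funext c _
  fin_cases c <;> rfl

end Convolutions

end InfFree

theorem mainTheorem4 (k m : ℕ) (K : Set ℝ) (hK : AccPt (0 : ℝ) (𝓟 K))
    (μ ν : ℝ → (FreeAlgebra ℂ (Fin m) →ₗ[ℂ] ℂ))
    (hμ : ∀ t ∈ K, μ t 1 = 1) (hν : ∀ t ∈ K, ν t 1 = 1)
    (μ' ν' : Fin (k + 1) → (FreeAlgebra ℂ (Fin m) →ₗ[ℂ] ℂ))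
    (hμ' : InfFree.HasDerivsAtZero K μ μ') (hν' : InfFree.HasDerivsAtZero K ν ν') :
    -- the four convolutions exist and are uniquely determined
    (∀ t ∈ K, ∃! σ, InfFree.IsFreeAddConv (μ t) (ν t) σ) ∧
    (∀ t ∈ K, ∃! τ, InfFree.IsFreeMulConv (μ t) (ν t) τ) ∧
    (∃! η, InfFree.IsInfFreeAddConv μ' ν' η) ∧
    (∃! θ, InfFree.IsInfFreeMulConv μ' ν' θ) ∧
    -- additive convolution
    (∀ (σ : ℝ → (FreeAlgebra ℂ (Fin m) →ₗ[ℂ] ℂ))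
        (η : Fin (k + 1) → (FreeAlgebra ℂ (Fin m) →ₗ[ℂ] ℂ)),
      (∀ t ∈ K, InfFree.IsFreeAddConv (μ t) (ν t) (σ t)) →
      InfFree.IsInfFreeAddConv μ' ν' η → InfFree.HasDerivsAtZero K σ η) ∧
    -- multiplicative convolution
    (∀ (τ : ℝ → (FreeAlgebra ℂ (Fin m) →ₗ[ℂ] ℂ))
        (θ : Fin (k + 1) → (FreeAlgebra ℂ (Fin m) →ₗ[ℂ] ℂ)),
      (∀ t ∈ K, InfFree.IsFreeMulConv (μ t) (ν t) (τ t)) →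
      InfFree.IsInfFreeMulConv μ' ν' θ → InfFree.HasDerivsAtZero K τ θ) := by
  have hsμ := hμ'.isInfState hK hμ
  have hsν := hν'.isInfState hK hν
  -- Being a convolution becomes equality with an explicit functional, which settles existence and
  -- uniqueness together.
  simp only [InfFree.isInfFreeAddConv_iff hsμ hsν, InfFree.isInfFreeMulConv_iff hsμ hsν]
  refine ⟨fun t ht => ?_, fun t ht => ?_, existsUnique_eq, existsUnique_eq, ?_, ?_⟩
  · simp only [InfFree.isFreeAddConv_iff (hμ t ht) (hν t ht)]
    exact existsUnique_eq
  · simp only [InfFree.isFreeMulConv_iff (hμ t ht) (hν t ht)]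
    exact existsUnique_eq
  · rintro σ _ hσ rfl
    exact InfFree.hasDerivsAtZero_distr_pairDistr hμ' hν' _ fun t ht =>
      (InfFree.isFreeAddConv_iff (hμ t ht) (hν t ht)).1 (hσ t ht)
  · rintro τ _ hτ rfl
    exact InfFree.hasDerivsAtZero_distr_pairDistr hμ' hν' _ fun t ht =>
      (InfFree.isFreeMulConv_iff (hμ t ht) (hν t ht)).1 (hτ t ht)
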